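/- Let $R$ be a noetherian commutative ring, $n\ge 0$, and let $I$ be an ideal of $R[[t]][x_1,\dots,x_n]$ that is $x$-homogeneous, i.e. generated by elements that are homogeneous in $x_1,\dots,x_n$ over $R[[t]]$. For $f=\sum c_{\beta,\alpha}t^\beta x^\alpha$ and $v\in\mathbb R_{<0}\times\mathbb R^n$ let $\mathrm{in}_v(f)\in R[t,x]$ be the sum of the terms $c_{\beta,\alpha}t^\beta x^\alpha$ of $f$ with $v\cdot(\beta,\alpha)$ maximal, and let $\mathrm{in}_v(I)\subseteq R[t,x]$ be the ideal generated by all $\mathrm{in}_v(f)$, $f\in I$. For $w\in\mathbb R_{<0}\times\mathbb R^n$ put $$C_w(I)=\overline{\{v\in\mathbb R_{<0}\times\mathbb R^n:\ \mathrm{in}_v(I)=\mathrm{in}_w(I)\}},\qquad C_w^0(I)=C_w(I)\cap(\{0\}\times\mathbb R^n),$$ with the closure taken in the Euclidean topology of $\mathbb R^{n+1}$. Then, for every $w\in\mathbb R_{<0}\times\mathbb R^n$, $C_w(I)$ and $C_w^0(I)$ are closed rational polyhedral cones, i.e. closed sets that are solution sets of finitely many homogeneous linear inequalities with integer coefficients.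 Moreover, let $>$ be any monomial ordering on the monomials $t^\beta x^\alpha$ (a total ordering compatible with multiplication, not necessarily a well-ordering), and let $>_w$ be the ordering that compares monomials first by $w\cdot(\beta,\alpha)$ and then by $>$. Write $\mathrm{lm}(f)$ and $\mathrm{lt}(f)$ for the $>_w$-greatest monomial of $f\neq0$ and the corresponding term, and $\mathrm{lt}(0)=0$; $\mathrm{lt}(I)\subseteq R[t,x]$ is the ideal generated by the $\mathrm{lt}(f)$, $f\in I$. For $g\in R[[t]][x]$ let $\Lambda(g)$ be the finite set of those $(\beta,\alpha)$ for which $t^\beta x^\alpha$ occurs in $g$ and $\beta$ is the least power of $t$ in the coefficient of $x^\alpha$ in $g$. An initially reduced standard basis of $I$ with respect to $>_w$ is a finite set $G\subseteq I$ such that $\{\mathrm{lt}(g):g\in G\}$ generates $\mathrm{lt}(I)$, no proper subset of $\{\mathrm{lt}(g):g\in G\}$ does, and for every $g\in G$ no term of $g$ with exponent in $\Lambda(g)$ other than $\mathrm{lt}(g)$ lies in $\mathrm{lt}(I)$. Such a $G$ exists, and for every such $G$ the cone $C_w(I)$ is the set of all $v\in\mathbb R_{\le0}\times\mathbb R^n$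 such that for all $g\in G$, with $\mathrm{lm}(g)=t^\delta x^\gamma$, $$v\cdot(\delta,\gamma)\ \ge\ v\cdot(\beta,\alpha)\quad\text{for all }(\beta,\alpha)\in\Lambda(g),$$ $$v\cdot(\beta,\alpha)=v\cdot(\beta',\alpha')\quad\text{for all exponents }(\beta,\alpha),(\beta',\alpha')\text{ of terms of }\mathrm{in}_w(g),$$ and $C_w^0(I)$ is the set of all $v\in\{0\}\times\mathbb R^n$ satisfying these same conditions. -/

import Mathlib

open scoped PowerSeries Polynomial

noncomputable section

namespace GroebnerFan

/-- Exponent vectors `(β, α)` of the monomials `t ^ β * x ^ α` in `t, x₁, …, xₙ`. Multiplication of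
monomials is addition of exponent vectors. -/
abbrev Mon (n : ℕ) : Type := ℕ × (Fin n →₀ ℕ)

/-- The mixed power series polynomial ring `R⟦t⟧[x₁, …, xₙ]`. -/
abbrev MixedRing (R : Type*) [CommRing R] (n : ℕ) : Type _ := MvPolynomial (Fin n) R⟦X⟧

/-- The polynomial ring `R[t, x₁, …, xₙ]`, written as `R[t][x₁, …, xₙ]`. -/
abbrev PolyRing (R : Type*) [CommRing R] (n : ℕ) : Type _ := MvPolynomial (Fin n) R[X]

/-- The space `ℝ × ℝⁿ` of weight vectors `(w₀, (w₁, …, wₙ))`; `w₀` is the weight of `t`. -/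
abbrev Weight (n : ℕ) : Type := ℝ × (Fin n → ℝ)

/-- The weighted degree `w · (β, α)`. -/
def wdeg {n : ℕ} (w : Weight n) (p : Mon n) : ℝ :=
  w.1 * (p.1 : ℝ) + ∑ i, w.2 i * (p.2 i : ℝ)

variable {R : Type*} [CommRing R] {n : ℕ}

/-- The coefficient of `t ^ β * x ^ α` in an element of `R⟦t⟧[x]`. -/
def tcoeff (f : MixedRing R n) (p : Mon n) : R :=
  PowerSeries.coeff p.1 (MvPolynomial.coeff p.2 f)

/-- The term `c * t ^ β * x ^ α` in `R[t, x]`. -/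
def term (p : Mon n) (c : R) : PolyRing R n :=
  MvPolynomial.monomial p.2 (Polynomial.monomial p.1 c)

open Classical in
/-- The finite set of exponents `(β, α)` such that `x ^ α` occurs in `f` and `β` is the least power
of `t` occurring in its coefficient. -/
def minExps (f : MixedRing R n) : Finset (Mon n) :=
  f.support.image fun α => ((PowerSeries.order (MvPolynomial.coeff α f)).toNat, α)

open Classical in
/-- The exponents of the monomials of `f` that are greatest with respect to `le` among all monomials
of `f`. As soon as `t * m` is strictly smaller than `m` for every monomial `m`, a greatest monomial
lies in `minExps f`; see `mem_topExps`. -/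
def topExps (le : Mon n → Mon n → Prop) (f : MixedRing R n) : Finset (Mon n) :=
  (minExps f).filter fun p => ∀ q, tcoeff f q ≠ 0 → le q p

/-- The sum of the terms of `f` whose monomials are greatest with respect to `le`. -/
def topForm (le : Mon n → Mon n → Prop) (f : MixedRing R n) : PolyRing R n :=
  ∑ p ∈ topExps le f, term p (tcoeff f p)

theorem mem_minExps (f : MixedRing R n) (p : Mon n) :
    p ∈ minExps f ↔ tcoeff f p ≠ 0 ∧ ∀ b < p.1, tcoeff f (b, p.2) = 0 := by
  obtain ⟨β, α⟩ := p
  simp only [minExps, tcoeff, Finset.mem_image, MvPolynomial.mem_support_iff, Prod.mk.injEq]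
  constructor
  · rintro ⟨α', h, hβ, rfl⟩
    subst hβ
    refine ⟨PowerSeries.coeff_order h, fun b hb => PowerSeries.coeff_of_lt_order_toNat b hb⟩
  · rintro ⟨h, hlt⟩
    have h0 : MvPolynomial.coeff α f ≠ 0 := by
      intro h0
      simp [h0] at h
    refine ⟨α, h0, ?_, rfl⟩
    have : PowerSeries.order (MvPolynomial.coeff α f) = (β : ℕ∞) :=
      PowerSeries.order_eq_nat.2 ⟨h, hlt⟩
    simp [this]

theorem mem_topExps {le : Mon n → Mon n → Prop}
    (hle : ∀ (b β : ℕ) (α : Fin n →₀ ℕ), b < β → ¬ le (b, α) (β, α))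
    (f : MixedRing R n) (p : Mon n) :
    p ∈ topExps le f ↔ tcoeff f p ≠ 0 ∧ ∀ q, tcoeff f q ≠ 0 → le q p := by
  simp only [topExps, Finset.mem_filter, mem_minExps]
  constructor
  · rintro ⟨⟨h, -⟩, h2⟩
    exact ⟨h, h2⟩
  · rintro ⟨h, h2⟩
    refine ⟨⟨h, fun b hb => ?_⟩, h2⟩
    by_contra hne
    exact hle b p.1 p.2 hb (h2 _ hne)

/-- Comparison of monomials by their weighted degree. -/
def weightLe (w : Weight n) (p q : Mon n) : Prop := wdeg w p ≤ wdeg w q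

/-- The initial form `in_w(f)`. It is used for weights with `w₀ < 0` only. -/
def initialForm (w : Weight n) (f : MixedRing R n) : PolyRing R n := topForm (weightLe w) f

/-- The initial ideal `in_w(I)` in `R[t, x]`. -/
def initialIdeal (w : Weight n) (I : Ideal (MixedRing R n)) : Ideal (PolyRing R n) :=
  Ideal.span (initialForm w '' (I : Set (MixedRing R n)))

/-- A monomial ordering, given by its non-strict relation: a total order that is compatible with
multiplication of monomials. It need not be a well-ordering. -/
structure IsMonomialOrdering (le : Mon n → Mon n → Prop) : Prop where
  refl : ∀ a, le a a
  trans : ∀ a b c, le a b → le b c → le a c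
  antisymm : ∀ a b, le a b → le b a → a = b
  total : ∀ a b, le a b ∨ le b a
  add_right : ∀ a b c, le a b → le (a + c) (b + c)

/-- The weighted ordering `>_w` with tie breaker `le`. -/
def weightedOrder (w : Weight n) (le : Mon n → Mon n → Prop) (p q : Mon n) : Prop :=
  wdeg w p < wdeg w q ∨ (wdeg w p = wdeg w q ∧ le p q)

/-- The leading term `lt_>(f)`, with `lt_>(0) = 0`, for a monomial ordering with `t < 1`. For
`f ≠ 0` the finset `topExps le f` is the singleton of the leading monomial. -/
def leadTerm (le : Mon n → Mon n → Prop) (f : MixedRing R n) : PolyRing R n := topForm le f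

/-- The ideal `lt_>(H)` of `R[t, x]` generated by the leading terms of the elements of `H`. -/
def leadIdeal (le : Mon n → Mon n → Prop) (H : Set (MixedRing R n)) : Ideal (PolyRing R n) :=
  Ideal.span (leadTerm le '' H)

/-- An ideal of `R⟦t⟧[x]` is `x`-homogeneous if it is generated by `x`-homogeneous elements. -/
def IsXHomogeneous (I : Ideal (MixedRing R n)) : Prop :=
  ∃ S : Set (MixedRing R n), (∀ f ∈ S, ∃ d : ℕ, f.IsHomogeneous d) ∧ I = Ideal.span S

/-- `G` is a standard basis of `I`. -/
def IsStandardBasis (le : Mon n → Mon n → Prop) (I : Ideal (MixedRing R n))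
    (G : Finset (MixedRing R n)) : Prop :=
  (G : Set (MixedRing R n)) ⊆ I ∧
    leadIdeal le (G : Set (MixedRing R n)) = leadIdeal le (I : Set (MixedRing R n))

/-- No proper subset of the set of leading terms of `G` generates the leading ideal of `I`. -/
def IsMinimalFor (le : Mon n → Mon n → Prop) (I : Ideal (MixedRing R n))
    (G : Finset (MixedRing R n)) : Prop :=
  ∀ S : Set (PolyRing R n), S ⊂ leadTerm le '' (G : Set (MixedRing R n)) →
    Ideal.span S ≠ leadIdeal le (I : Set (MixedRing R n))

/-- For `g = ∑ g_α x ^ α` put `g' = ∑ lt(g_α) x ^ α`; the exponents of the terms of `g'` are those in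
`minExps g`. `G` is initially reduced with respect to `H` if, for every `g ∈ G`, no term of `g'`
other than the leading term lies in `lt_>(H)`. -/
def IsInitiallyReducedWrt (le : Mon n → Mon n → Prop) (G H : Finset (MixedRing R n)) : Prop :=
  ∀ g ∈ G, ∀ p ∈ minExps g, p ∉ topExps le g →
    term p (tcoeff g p) ∉ leadIdeal le (H : Set (MixedRing R n))

/-- `G` is an initially reduced standard basis of `I`. -/
def IsInitiallyReducedStandardBasis (le : Mon n → Mon n → Prop) (I : Ideal (MixedRing R n))
    (G : Finset (MixedRing R n)) : Prop :=
  IsStandardBasis le I G ∧ IsMinimalFor le I G ∧ IsInitiallyReducedWrt le G G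

/-- The interior Gröbner cone `C_w(I)`: the closure of the set of all weights `v` with `v₀ < 0` and
`in_v(I) = in_w(I)`. -/
def groebnerCone (I : Ideal (MixedRing R n)) (w : Weight n) : Set (Weight n) :=
  closure {v | v.1 < 0 ∧ initialIdeal v I = initialIdeal w I}

/-- The boundary Gröbner cone `C_w^0(I)`. -/
def boundaryGroebnerCone (I : Ideal (MixedRing R n)) (w : Weight n) : Set (Weight n) :=
  groebnerCone I w ∩ {v | v.1 = 0}

/-- A rational polyhedral cone in `ℝ × ℝⁿ`: the solution set of finitely many homogeneous linear
inequalities with integer coefficients. -/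
def IsRationalPolyhedralCone (C : Set (Weight n)) : Prop :=
  ∃ A : Finset (ℤ × (Fin n → ℤ)),
    C = {v | ∀ a ∈ A, 0 ≤ v.1 * (a.1 : ℝ) + ∑ i, v.2 i * (a.2 i : ℝ)}

/-- The conditions on a weight `v` read off from `G`: for each `g ∈ G` the leading monomial of `g`
with respect to `>_w` has `v`-degree at least that of every monomial in `minExps g`, and all
monomials of `in_w(g)` have the same `v`-degree. -/
def SatisfiesSystem (w : Weight n) (le : Mon n → Mon n → Prop) (G : Finset (MixedRing R n))
    (v : Weight n) : Prop :=
  ∀ g ∈ G,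
    (∀ m ∈ topExps (weightedOrder w le) g, ∀ p ∈ minExps g, wdeg v p ≤ wdeg v m) ∧
    (∀ p ∈ topExps (weightLe w) g, ∀ q ∈ topExps (weightLe w) g, wdeg v p = wdeg v q)

end GroebnerFan

end

/-!
Homogeneity in `x` confines every reduction to monomials of bounded `x`-degree, of which only
finitely many lie above a given one, and by Krull's intersection theorem the part of `I` of bounded
`x`-degree is `t`-adically closed. Hence normal forms modulo `I` exist, although reduction need not
terminate, and with them initially reduced standard bases `G` for `>_w`.

If `in_v(I) = in_w(I)` and `g ∈ G`, then reducedness leaves the leading monomial of `g` as the only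
monomial of `in_v(g)` and of `in_v(g) - in_w(g)` that could be leading; so it occurs in `in_v(g)`,
and `in_v(g) = in_w(g)` because it cancels in the difference. Conversely, if `in_v(g) = in_w(g)` for
all `g ∈ G`, then `lt(I)` for `>_w` is contained in `lt(I)` for `>_v`; the two are equal by
comparing normal forms, so `G` is a standard basis for `>_v` too, and both initial ideals are
generated by the `in_w(g)`. A solution `v` of the system with `v₀ ≤ 0` is the limit of the weights
`v + ε w` as `ε → 0+`, for which the initial forms of `G` are those for `w`.
-/

noncomputable section

namespace GroebnerFan

variable {R : Type*} [CommRing R] {n : ℕ}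

/-! ### Coefficients and terms -/

/-- The coefficients of `t ^ β * x ^ α` in an element of `R[t, x]`, as an additive map; the
counterpart of `tcoeff`. -/
def pcoeff : PolyRing R n →+ (Mon n → R) :=
  AddMonoidHom.mk' (fun f q => (MvPolynomial.coeff q.2 f).coeff q.1) fun f g => by ext; simp

/-- The term `c * t ^ β * x ^ α` in `R⟦t⟧[x]`; the counterpart of `term`. -/
def mixedTerm (p : Mon n) (c : R) : MixedRing R n :=
  MvPolynomial.monomial p.2 (PowerSeries.C c * PowerSeries.X ^ p.1)

@[simp] theorem tcoeff_zero : tcoeff (0 : MixedRing R n) = 0 := by ext; simp [tcoeff]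

@[simp] theorem tcoeff_add (f g : MixedRing R n) : tcoeff (f + g) = tcoeff f + tcoeff g := by
  ext; simp [tcoeff]

@[simp] theorem tcoeff_sub (f g : MixedRing R n) : tcoeff (f - g) = tcoeff f - tcoeff g := by
  ext; simp [tcoeff]

theorem tcoeff_injective : Function.Injective (tcoeff (R := R) (n := n)) := fun _ _ h =>
  MvPolynomial.ext _ _ fun α => PowerSeries.ext fun β => congrFun h (β, α)

theorem pcoeff_injective : Function.Injective (pcoeff (R := R) (n := n)) := fun _ _ h =>
  MvPolynomial.ext _ _ fun α => Polynomial.ext fun β => congrFun h (β, α)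

theorem pcoeff_term (p : Mon n) (c : R) : pcoeff (term p c) = Pi.single p c := by
  ext q
  by_cases hα : p.2 = q.2 <;> by_cases hβ : p.1 = q.1 <;>
    simp [pcoeff, term, Pi.single_apply, MvPolynomial.coeff_monomial, Polynomial.coeff_monomial,
      Prod.ext_iff, hα, hβ, eq_comm]

theorem tcoeff_mixedTerm (p : Mon n) (c : R) : tcoeff (mixedTerm p c) = Pi.single p c := by
  ext q
  by_cases hα : p.2 = q.2 <;> by_cases hβ : p.1 = q.1 <;>
    simp [tcoeff, mixedTerm, Pi.single_apply, MvPolynomial.coeff_monomial,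
      PowerSeries.coeff_X_pow, Prod.ext_iff, hα, hβ, eq_comm]

theorem term_zero (p : Mon n) : term p (0 : R) = 0 := by simp [term]

theorem term_mul_term (p q : Mon n) (c d : R) : term p c * term q d = term (p + q) (c * d) := by
  simp [term, MvPolynomial.monomial_mul, Polynomial.monomial_mul_monomial]

open Classical in
theorem pcoeff_term_mul (u q : Mon n) (c : R) (f : PolyRing R n) :
    pcoeff (term u c * f) q = if u ≤ q then c * pcoeff f (q - u) else 0 := by
  by_cases hα : u.2 ≤ q.2 <;> by_cases hβ : u.1 ≤ q.1 <;>
    simp [pcoeff, term, MvPolynomial.coeff_monomial_mul', Prod.le_def, hα, hβ,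
      ← Polynomial.C_mul_X_pow_eq_monomial, mul_assoc, Polynomial.coeff_X_pow_mul']

open Classical in
theorem tcoeff_mixedTerm_mul (u q : Mon n) (c : R) (f : MixedRing R n) :
    tcoeff (mixedTerm u c * f) q = if u ≤ q then c * tcoeff f (q - u) else 0 := by
  by_cases hα : u.2 ≤ q.2 <;> by_cases hβ : u.1 ≤ q.1 <;>
    simp [tcoeff, mixedTerm, MvPolynomial.coeff_monomial_mul', Prod.le_def, hα, hβ,
      mul_assoc, PowerSeries.coeff_X_pow_mul']

theorem polyRing_induction {P : PolyRing R n → Prop} (add : ∀ a b, P a → P b → P (a + b))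
    (term : ∀ u c, P (term u c)) (a : PolyRing R n) : P a := by
  induction a using MvPolynomial.induction_on' with
  | monomial α a =>
    induction a using Polynomial.induction_on' with
    | add a b ha hb => rw [map_add]; exact add _ _ ha hb
    | monomial β c => exact term (β, α) c
  | add a b ha hb => exact add _ _ ha hb

theorem span_term_induction {S : Set (PolyRing R n)}
    {P : (p : PolyRing R n) → p ∈ Ideal.span S → Prop}
    (mem : ∀ x hx, P x (Ideal.subset_span hx)) (zero : P 0 (Ideal.zero_mem _))
    (add : ∀ x y hx hy, P x hx → P y hy → P (x + y) (Ideal.add_mem _ hx hy))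
    (term_mul : ∀ u c x hx, P x hx → P (term u c * x) (Ideal.mul_mem_left _ _ hx))
    {p : PolyRing R n} (hp : p ∈ Ideal.span S) : P p hp := by
  induction hp using Submodule.span_induction with
  | mem x hx => exact mem x hx
  | zero => exact zero
  | add x y hx hy ihx ihy => exact add x y hx hy ihx ihy
  | smul a x hx ih =>
    induction a using polyRing_induction with
    | add a b ha hb =>
      have := add _ _ _ _ ha hb
      simpa only [add_smul] using this
    | term u c => exact term_mul u c x hx ih

theorem finite_support_pcoeff (p : PolyRing R n) : (pcoeff p).support.Finite := by
  induction p using polyRing_induction with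
  | add a b ha hb =>
    rw [map_add]
    exact (ha.union hb).subset (Function.support_add _ _)
  | term u c =>
    rw [pcoeff_term]
    exact (Set.finite_singleton u).subset Pi.support_single_subset

/-- The exponents of total degree at most `D` in `x₁, …, xₙ`; the exponent of `t` is arbitrary. -/
def degreeLE (n D : ℕ) : Set (Mon n) := {q | q.2.degree ≤ D}

theorem degreeLE_mono {D D' : ℕ} (h : D ≤ D') : degreeLE n D ⊆ degreeLE n D' := fun _ hq =>
  le_trans (α := ℕ) hq h

theorem finite_degree_le (D : ℕ) : {α : Fin n →₀ ℕ | α.degree ≤ D}.Finite :=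
  Finsupp.finite_of_degree_le D

theorem support_tcoeff_subset_degreeLE (f : MixedRing R n) :
    (tcoeff f).support ⊆ degreeLE n f.totalDegree := fun q hq => by
  refine MvPolynomial.le_totalDegree (s := q.2) (MvPolynomial.mem_support_iff.2 fun h => hq ?_)
  simp [tcoeff, h]

theorem exists_tcoeff_eq {D : ℕ} {F : Mon n → R} (hF : F.support ⊆ degreeLE n D) :
    ∃ f : MixedRing R n, tcoeff f = F := by
  refine ⟨∑ α ∈ (finite_degree_le (n := n) D).toFinset,
    MvPolynomial.monomial α (PowerSeries.mk fun β => F (β, α)), ?_⟩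
  ext q
  by_cases hq : q.2.degree ≤ D
  · simp [tcoeff, MvPolynomial.coeff_sum, MvPolynomial.coeff_monomial, hq]
  · have : F q = 0 := Function.notMem_support.1 fun h => hq (hF h)
    simp [tcoeff, MvPolynomial.coeff_sum, MvPolynomial.coeff_monomial, hq, this]

/-! ### Homogeneity -/

theorem tcoeff_homogeneousComponent (d : ℕ) (f : MixedRing R n) (q : Mon n) :
    tcoeff (MvPolynomial.homogeneousComponent d f) q =
      if q.2.degree = d then tcoeff f q else 0 := by
  rw [tcoeff, MvPolynomial.coeff_homogeneousComponent, apply_ite (PowerSeries.coeff q.1), map_zero,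
    tcoeff]

theorem degree_eq_of_isHomogeneous {f : MixedRing R n} {d : ℕ} (hf : f.IsHomogeneous d)
    {q : Mon n} (hq : tcoeff f q ≠ 0) : q.2.degree = d := by
  rw [Finsupp.degree_eq_weight_one]
  refine hf fun h => hq ?_
  simp [tcoeff, h]

theorem isHomogeneous_of_degree_eq {f : MixedRing R n} {d : ℕ}
    (hf : ∀ q, tcoeff f q ≠ 0 → q.2.degree = d) : f.IsHomogeneous d := fun α hα => by
  obtain ⟨β, hβ⟩ := PowerSeries.exists_coeff_ne_zero_iff_ne_zero.2 hα
  rw [← hf (β, α) hβ, Finsupp.degree_eq_weight_one]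
  rfl

theorem IsXHomogeneous.homogeneousComponent_mem {I : Ideal (MixedRing R n)} (hI : IsXHomogeneous I)
    {f : MixedRing R n} (hf : f ∈ I) (d : ℕ) : MvPolynomial.homogeneousComponent d f ∈ I := by
  obtain ⟨S, hS, rfl⟩ := hI
  let _ := MvPolynomial.gradedAlgebra (σ := Fin n) (R := R⟦X⟧)
  exact MvPolynomial.homogeneousComponent_mem_of_mem
    (Ideal.homogeneous_span (MvPolynomial.homogeneousSubmodule (Fin n) R⟦X⟧) S hS) hf d

/-! ### Preorders on monomials -/

/-- Total preorders on monomials that are compatible with multiplication and allow, in bounded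
`x`-degree, only finitely many monomials above a given one; the last condition forces `t < 1`.
Examples are the comparison by a weight `w` with `w₀ < 0` and its refinements. -/
structure IsTermPreorder (le : Mon n → Mon n → Prop) : Prop where
  trans : ∀ {a b c}, le a b → le b c → le a c
  total : ∀ a b, le a b ∨ le b a
  add_iff : ∀ a b c, le (a + c) (b + c) ↔ le a b
  finite_ge : ∀ D q, (degreeLE n D ∩ {p | le q p}).Finite

/-- Term preorders that are total orders. -/
structure IsTermOrder (le : Mon n → Mon n → Prop) : Prop extends IsTermPreorder le where
  antisymm : ∀ {a b}, le a b → le b a → a = b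

namespace IsTermPreorder

variable {le : Mon n → Mon n → Prop}

theorem refl (hle : IsTermPreorder le) (a : Mon n) : le a a := or_self_iff.1 (hle.total a a)

theorem not_le_of_lt (hle : IsTermPreorder le) {b β : ℕ} (α : Fin n →₀ ℕ) (h : b < β) :
    ¬ le (b, α) (β, α) := by
  intro hbβ
  -- By compatibility all the powers `t ^ (k * (β - b))` would lie above `1`.
  have step (k : ℕ) : le (k * (β - b), 0) ((k + 1) * (β - b), 0) := by
    rw [← hle.add_iff _ _ (b, α)]
    convert (hle.add_iff _ _ (k * (β - b), 0)).2 hbβ using 1 <;>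
      simp [add_mul] <;> omega
  have powers (k : ℕ) : (k * (β - b), 0) ∈ degreeLE n 0 ∩ {p | le 0 p} := by
    refine ⟨by simp [degreeLE], ?_⟩
    induction k with
    | zero =>
      rw [zero_mul]
      exact hle.refl 0
    | succ k ih => exact hle.trans ih (step k)
  refine Set.infinite_of_injective_forall_mem (fun k l hkl => ?_) powers (hle.finite_ge 0 0)
  exact Nat.eq_of_mul_eq_mul_right (Nat.sub_pos_of_lt h) (congrArg Prod.fst hkl)

theorem exists_greatest (hle : IsTermPreorder le) {s : Set (Mon n)} (hs : s.Finite)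
    (hne : s.Nonempty) : ∃ m ∈ s, ∀ q ∈ s, le q m := by
  let _ : LE (Mon n) := ⟨le⟩
  have : IsTrans (Mon n) (· ≤ ·) := ⟨fun _ _ _ => hle.trans⟩
  obtain ⟨m, hm, hmax⟩ := hs.exists_maximal hne
  exact ⟨m, hm, fun q hq => (hle.total q m).elim id (hmax hq)⟩

theorem exists_greatest_of_ne_zero (hle : IsTermPreorder le) {p : PolyRing R n} (hp : p ≠ 0) :
    ∃ m, pcoeff p m ≠ 0 ∧ ∀ q, pcoeff p q ≠ 0 → le q m :=
  hle.exists_greatest (finite_support_pcoeff p)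
    (Function.support_nonempty_iff.2 ((map_ne_zero_iff _ pcoeff_injective).2 hp))

end IsTermPreorder

/-! ### Top forms -/

theorem topExps_subset_minExps (le : Mon n → Mon n → Prop) (f : MixedRing R n) :
    topExps le f ⊆ minExps f := by
  classical
  exact Finset.filter_subset _ _

theorem pcoeff_topForm (le : Mon n → Mon n → Prop) (f : MixedRing R n) :
    pcoeff (topForm le f) = (topExps le f : Set (Mon n)).indicator (tcoeff f) := by
  classical
  ext q
  simp [topForm, pcoeff_term, Finset.sum_apply, Set.indicator_apply, Pi.single_apply]

theorem pcoeff_topForm_of_mem {le : Mon n → Mon n → Prop} {f : MixedRing R n} {q : Mon n}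
    (hq : q ∈ topExps le f) : pcoeff (topForm le f) q = tcoeff f q := by
  rw [pcoeff_topForm, Set.indicator_of_mem hq]

theorem pcoeff_topForm_of_notMem {le : Mon n → Mon n → Prop} {f : MixedRing R n} {q : Mon n}
    (hq : q ∉ topExps le f) : pcoeff (topForm le f) q = 0 := by
  rw [pcoeff_topForm, Set.indicator_of_notMem hq]

@[simp] theorem topForm_zero (le : Mon n → Mon n → Prop) :
    topForm le (0 : MixedRing R n) = 0 := by
  simp [topForm, term_zero]

theorem support_pcoeff_topForm (le : Mon n → Mon n → Prop) (f : MixedRing R n) :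
    (pcoeff (topForm le f)).support = topExps le f := by
  rw [pcoeff_topForm, Set.support_indicator, Set.inter_eq_left]
  exact fun q hq => ((mem_minExps f q).1 (topExps_subset_minExps le f hq)).1

theorem topForm_eq_iff {le₁ le₂ : Mon n → Mon n → Prop} {f : MixedRing R n} :
    topForm le₁ f = topForm le₂ f ↔ topExps le₁ f = topExps le₂ f := by
  refine ⟨fun h => Finset.coe_injective ?_, fun h => by rw [topForm, topForm, h]⟩
  rw [← support_pcoeff_topForm, h, support_pcoeff_topForm]

namespace IsTermPreorder

variable {le : Mon n → Mon n → Prop} {f : MixedRing R n}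

theorem mem_topExps (hle : IsTermPreorder le) {p : Mon n} :
    p ∈ topExps le f ↔ tcoeff f p ≠ 0 ∧ ∀ q, tcoeff f q ≠ 0 → le q p :=
  GroebnerFan.mem_topExps (fun _ _ α => hle.not_le_of_lt α) f p

theorem exists_mem_minExps_ge (hle : IsTermPreorder le) {q : Mon n} (hq : tcoeff f q ≠ 0) :
    ∃ p ∈ minExps f, p.2 = q.2 ∧ le q p := by
  classical
  have hex : ∃ b, tcoeff f (b, q.2) ≠ 0 := ⟨q.1, hq⟩
  refine ⟨(Nat.find hex, q.2), (mem_minExps _ _).2 ⟨Nat.find_spec hex, fun b hb =>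
    not_not.1 (Nat.find_min hex hb)⟩, rfl, ?_⟩
  rcases (Nat.find_min' hex hq).eq_or_lt with h | h
  · rw [h]
    exact hle.refl q
  · exact (hle.total _ _).resolve_right (hle.not_le_of_lt q.2 h)

theorem mem_topExps_iff_minExps (hle : IsTermPreorder le) {p : Mon n} :
    p ∈ topExps le f ↔ p ∈ minExps f ∧ ∀ q ∈ minExps f, le q p := by
  refine ⟨fun hp => ⟨topExps_subset_minExps _ _ hp, fun q hq =>
    (hle.mem_topExps.1 hp).2 q ((mem_minExps f q).1 hq).1⟩, fun ⟨hp, hmax⟩ =>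
    hle.mem_topExps.2 ⟨((mem_minExps f p).1 hp).1, fun q hq => ?_⟩⟩
  obtain ⟨q', hq', -, hqq'⟩ := hle.exists_mem_minExps_ge hq
  exact hle.trans hqq' (hmax q' hq')

theorem mem_topExps_iff_of_mem (hle : IsTermPreorder le) {m p : Mon n} (hm : m ∈ topExps le f) :
    p ∈ topExps le f ↔ p ∈ minExps f ∧ le m p := by
  rw [hle.mem_topExps_iff_minExps] at hm ⊢
  exact and_congr_right fun _ => ⟨fun h => h m hm.1, fun h q hq => hle.trans (hm.2 q hq) h⟩

theorem topExps_nonempty (hle : IsTermPreorder le) (hf : f ≠ 0) : (topExps le f).Nonempty := by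
  obtain ⟨q, hq⟩ := Function.ne_iff.1 (tcoeff_injective.ne hf)
  obtain ⟨p, hp, -⟩ := hle.exists_mem_minExps_ge (by simpa using hq)
  obtain ⟨m, hm, hmax⟩ := hle.exists_greatest (minExps f).finite_toSet ⟨p, hp⟩
  exact ⟨m, hle.mem_topExps_iff_minExps.2 ⟨hm, hmax⟩⟩

theorem topForm_ne_zero (hle : IsTermPreorder le) (hf : f ≠ 0) : topForm le f ≠ 0 := by
  obtain ⟨m, hm⟩ := hle.topExps_nonempty hf
  intro h0
  refine (hle.mem_topExps.1 hm).1 ?_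
  rw [← pcoeff_topForm_of_mem hm, h0, map_zero, Pi.zero_apply]

end IsTermPreorder

namespace IsTermOrder

variable {le : Mon n → Mon n → Prop} {f : MixedRing R n} {m : Mon n}

theorem topExps_eq_singleton (hle : IsTermOrder le) (hm : m ∈ topExps le f) :
    topExps le f = {m} := by
  refine Finset.eq_singleton_iff_unique_mem.2 ⟨hm, fun q hq => ?_⟩
  rw [hle.mem_topExps] at hm hq
  exact hle.antisymm (hm.2 q hq.1) (hq.2 m hm.1)

theorem leadTerm_eq (hle : IsTermOrder le) (hm : m ∈ topExps le f) :
    leadTerm le f = term m (tcoeff f m) := by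
  simp [leadTerm, topForm, hle.topExps_eq_singleton hm]

theorem term_mem_leadIdeal (hle : IsTermOrder le) {H : Set (MixedRing R n)} (hf : f ∈ H)
    (hm : m ∈ topExps le f) : term m (tcoeff f m) ∈ leadIdeal le H :=
  Ideal.subset_span ⟨f, hf, hle.leadTerm_eq hm⟩

end IsTermOrder

/-! ### Lifting leading ideals -/

/-- `f` lifts `p` at `q₀`: no monomial of `f` exceeds `q₀`, and `f` and `p` have the same
coefficients at all monomials equivalent to `q₀`. -/
structure IsLift (le : Mon n → Mon n → Prop) (q₀ : Mon n) (f : MixedRing R n) (p : PolyRing R n) :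
    Prop where
  le_of_ne_zero : ∀ q, tcoeff f q ≠ 0 → le q q₀
  tcoeff_eq : ∀ q, le q q₀ → le q₀ q → tcoeff f q = pcoeff p q

namespace IsLift

variable {le : Mon n → Mon n → Prop} {q₀ : Mon n} {f g : MixedRing R n} {p r : PolyRing R n}

theorem zero_left (h : ∀ q, le q q₀ → le q₀ q → pcoeff p q = 0) : IsLift le q₀ 0 p where
  le_of_ne_zero q hq := absurd (congrFun tcoeff_zero q) hq
  tcoeff_eq q h₁ h₂ := by simp [h q h₁ h₂]

theorem add (hf : IsLift le q₀ f p) (hg : IsLift le q₀ g r) : IsLift le q₀ (f + g) (p + r) where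
  le_of_ne_zero q hq := by
    rw [tcoeff_add] at hq
    exact (Function.support_add _ _ hq).elim (hf.le_of_ne_zero q) (hg.le_of_ne_zero q)
  tcoeff_eq q h₁ h₂ := by simp [hf.tcoeff_eq q h₁ h₂, hg.tcoeff_eq q h₁ h₂]

theorem of_equiv (hle : IsTermPreorder le) {q₁ : Mon n} (hf : IsLift le q₀ f p) (h : le q₀ q₁)
    (h' : le q₁ q₀) : IsLift le q₁ f p where
  le_of_ne_zero q hq := hle.trans (hf.le_of_ne_zero q hq) h
  tcoeff_eq q h₁ h₂ := hf.tcoeff_eq q (hle.trans h₁ h') (hle.trans h h₂)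

theorem term_mul (hle : IsTermPreorder le) (u : Mon n) (c : R) (hf : IsLift le q₀ f p) :
    IsLift le (q₀ + u) (mixedTerm u c * f) (term u c * p) where
  le_of_ne_zero q hq := by
    rw [tcoeff_mixedTerm_mul] at hq
    split_ifs at hq with hu
    · rw [← tsub_add_cancel_of_le hu, hle.add_iff]
      exact hf.le_of_ne_zero _ (right_ne_zero_of_mul hq)
    · exact absurd rfl hq
  tcoeff_eq q h₁ h₂ := by
    rw [tcoeff_mixedTerm_mul, pcoeff_term_mul]
    split_ifs with hu
    · rw [← tsub_add_cancel_of_le hu, hle.add_iff] at h₁ h₂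
      rw [hf.tcoeff_eq _ h₁ h₂]
    · rfl

end IsLift

theorem IsTermPreorder.isLift_topForm {le : Mon n → Mon n → Prop} (hle : IsTermPreorder le)
    {f : MixedRing R n} {m : Mon n} (hm : m ∈ topExps le f) : IsLift le m f (topForm le f) where
  le_of_ne_zero := (hle.mem_topExps.1 hm).2
  tcoeff_eq q _ hmq := by
    by_cases hq : q ∈ topExps le f
    · exact (pcoeff_topForm_of_mem hq).symm
    · rw [pcoeff_topForm_of_notMem hq]
      refine not_not.1 fun hne => hq (hle.mem_topExps.2 ⟨hne, fun p hp => ?_⟩)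
      exact hle.trans ((hle.mem_topExps.1 hm).2 p hp) hmq

theorem IsTermPreorder.exists_isLift {le : Mon n → Mon n → Prop} (hle : IsTermPreorder le)
    {I : Ideal (MixedRing R n)} {p : PolyRing R n}
    (hp : p ∈ leadIdeal le (I : Set (MixedRing R n))) (q₀ : Mon n) :
    ∃ f ∈ I, IsLift le q₀ f p := by
  induction hp using span_term_induction generalizing q₀ with
  | mem τ hτ =>
    obtain ⟨f, hf, rfl⟩ := hτ
    by_cases hex : ∃ m ∈ topExps le f, le m q₀ ∧ le q₀ m
    · obtain ⟨m, hm, h₁, h₂⟩ := hex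
      exact ⟨f, hf, (hle.isLift_topForm hm).of_equiv hle h₁ h₂⟩
    · refine ⟨0, I.zero_mem, IsLift.zero_left fun q h₁ h₂ => ?_⟩
      exact pcoeff_topForm_of_notMem fun hq => hex ⟨q, hq, h₁, h₂⟩
  | zero => exact ⟨0, I.zero_mem, IsLift.zero_left fun q _ _ => by simp⟩
  | add a b _ _ iha ihb =>
    obtain ⟨f, hf, hfa⟩ := iha q₀
    obtain ⟨g, hg, hgb⟩ := ihb q₀
    exact ⟨f + g, I.add_mem hf hg, hfa.add hgb⟩
  | term_mul u c x _ ih =>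
    by_cases hex : ∃ q₁, le (q₁ + u) q₀ ∧ le q₀ (q₁ + u)
    · obtain ⟨q₁, h₁, h₂⟩ := hex
      obtain ⟨f, hf, hfx⟩ := ih q₁
      exact ⟨_, I.mul_mem_left _ hf, (hfx.term_mul hle u c).of_equiv hle h₁ h₂⟩
    · refine ⟨0, I.zero_mem, IsLift.zero_left fun q h₁ h₂ => ?_⟩
      rw [pcoeff_term_mul, if_neg fun hu => hex ⟨q - u, ?_⟩]
      rw [tsub_add_cancel_of_le hu]
      exact ⟨h₁, h₂⟩

theorem IsTermPreorder.exists_homogeneous_lift {le : Mon n → Mon n → Prop} (hle : IsTermPreorder le)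
    {I : Ideal (MixedRing R n)} (hI : IsXHomogeneous I) {q : Mon n} {c : R}
    (h : term q c ∈ leadIdeal le (I : Set (MixedRing R n))) :
    ∃ f ∈ I, tcoeff f q = c ∧ ∀ p, tcoeff f p ≠ 0 → le p q ∧ p.2.degree = q.2.degree := by
  obtain ⟨f, hf, hfq⟩ := hle.exists_isLift h q
  refine ⟨_, hI.homogeneousComponent_mem hf q.2.degree, ?_, fun p hp => ?_⟩
  · rw [tcoeff_homogeneousComponent, if_pos rfl, hfq.tcoeff_eq q (hle.refl q) (hle.refl q),
      pcoeff_term, Pi.single_eq_same]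
  · rw [tcoeff_homogeneousComponent] at hp
    obtain ⟨hd, hp⟩ := ite_ne_right_iff.1 hp
    exact ⟨hfq.le_of_ne_zero p hp, hd⟩

/-! ### Ideals are `t`-adically closed in bounded degree -/

theorem mem_restrictTotalDegree_iff {f : MixedRing R n} {D : ℕ} :
    f ∈ MvPolynomial.restrictTotalDegree (Fin n) R⟦X⟧ D ↔ (tcoeff f).support ⊆ degreeLE n D := by
  rw [MvPolynomial.mem_restrictTotalDegree]
  refine ⟨fun h => (support_tcoeff_subset_degreeLE f).trans (degreeLE_mono h), fun h =>
    Finset.sup_le fun α hα => ?_⟩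
  obtain ⟨β, hβ⟩ :=
    PowerSeries.exists_coeff_ne_zero_iff_ne_zero.2 (MvPolynomial.mem_support_iff.1 hα)
  exact h (a := (β, α)) hβ

theorem exists_X_pow_smul_eq {f : MixedRing R n} {D N : ℕ} (hD : (tcoeff f).support ⊆ degreeLE n D)
    (hN : ∀ q : Mon n, q.1 < N → tcoeff f q = 0) :
    ∃ g ∈ MvPolynomial.restrictTotalDegree (Fin n) R⟦X⟧ D,
      (PowerSeries.X ^ N : R⟦X⟧) • g = f := by
  have hsupp : (fun q : Mon n => tcoeff f (q.1 + N, q.2)).support ⊆ degreeLE n D :=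
    fun q hq => hD (a := (q.1 + N, q.2)) hq
  obtain ⟨g, hg⟩ := exists_tcoeff_eq hsupp
  refine ⟨g, mem_restrictTotalDegree_iff.2 (hg ▸ hsupp), tcoeff_injective (funext fun q => ?_)⟩
  rw [tcoeff, MvPolynomial.coeff_smul, smul_eq_mul, PowerSeries.coeff_X_pow_mul']
  split_ifs with hq
  · simpa [tcoeff, Nat.sub_add_cancel hq] using congrFun hg (q.1 - N, q.2)
  · exact (hN q (not_le.1 hq)).symm

theorem mem_of_forall_exists_sub_mem_pow_smul_top {A M : Type*} [CommRing A] [IsNoetherianRing A]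
    [AddCommGroup M] [Module A M] [Module.Finite A M] {J : Ideal A} (hJ : J ≤ Ideal.jacobson ⊥)
    (N : Submodule A M) {x : M} (h : ∀ k : ℕ, ∃ y ∈ N, x - y ∈ J ^ k • (⊤ : Submodule A M)) :
    x ∈ N := by
  rw [← Submodule.Quotient.mk_eq_zero, ← Submodule.mem_bot A,
    ← Ideal.iInf_pow_smul_eq_bot_of_le_jacobson J hJ, Submodule.mem_iInf]
  intro k
  obtain ⟨y, hy, hxy⟩ := h k
  have hmap := Submodule.mem_map_of_mem (f := N.mkQ) hxy
  rw [Submodule.map_smul'', map_sub, N.mkQ_apply y, (Submodule.Quotient.mk_eq_zero N).2 hy,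
    sub_zero] at hmap
  exact smul_mono_right (J ^ k) (le_top (a := (⊤ : Submodule A M).map N.mkQ)) hmap

theorem mem_of_forall_exists_congr [IsNoetherianRing R] {I : Ideal (MixedRing R n)}
    {f : MixedRing R n} {D : ℕ} (hf : (tcoeff f).support ⊆ degreeLE n D)
    (h : ∀ N, ∃ g ∈ I, (tcoeff g).support ⊆ degreeLE n D ∧
      ∀ q : Mon n, q.1 < N → tcoeff g q = tcoeff f q) : f ∈ I := by
  have hX : Ideal.span {(PowerSeries.X : R⟦X⟧)} ≤ Ideal.jacobson ⊥ :=
    IsAdicComplete.le_jacobson_bot _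
  let M := MvPolynomial.restrictTotalDegree (Fin n) R⟦X⟧ D
  let N : Submodule R⟦X⟧ M := (I.restrictScalars R⟦X⟧).comap M.subtype
  let f' : M := ⟨f, mem_restrictTotalDegree_iff.2 hf⟩
  suffices f' ∈ N from this
  refine mem_of_forall_exists_sub_mem_pow_smul_top (M := M) hX N fun k => ?_
  obtain ⟨g, hgI, hgD, hgf⟩ := h k
  obtain ⟨s, hs, hsfg⟩ := exists_X_pow_smul_eq (f := f - g) (D := D) (N := k)
    (by rw [tcoeff_sub]; exact (Function.support_sub _ _).trans (Set.union_subset hf hgD))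
    (fun q hq => by simp [hgf q hq])
  refine ⟨⟨g, mem_restrictTotalDegree_iff.2 hgD⟩, hgI, ?_⟩
  have hfg : f' - ⟨g, mem_restrictTotalDegree_iff.2 hgD⟩ =
      (PowerSeries.X ^ k : R⟦X⟧) • (⟨s, hs⟩ : M) := Subtype.ext hsfg.symm
  rw [hfg, Ideal.span_singleton_pow]
  exact Submodule.smul_mem_smul (Ideal.mem_span_singleton_self _) Submodule.mem_top

theorem exists_mem_eventually_tcoeff_eq [IsNoetherianRing R] {I : Ideal (MixedRing R n)}
    {h : ℕ → MixedRing R n} (hI : ∀ k, h k ∈ I) {D : ℕ}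
    (hD : ∀ k, (tcoeff (h k)).support ⊆ degreeLE n D)
    (hconst : ∀ q, ∃ c, ∀ᶠ k in Filter.atTop, tcoeff (h k) q = c) :
    ∃ f ∈ I, ∀ q, ∀ᶠ k in Filter.atTop, tcoeff (h k) q = tcoeff f q := by
  choose c hc using hconst
  have hcD : c.support ⊆ degreeLE n D := fun q hq => by
    obtain ⟨k, hk⟩ := (hc q).exists
    exact hD k (a := q) (by rwa [Function.mem_support, hk])
  obtain ⟨f, rfl⟩ := exists_tcoeff_eq hcD
  refine ⟨f, mem_of_forall_exists_congr hcD fun N => ?_, hc⟩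
  have hfin : {q : Mon n | q.1 < N ∧ q ∈ degreeLE n D}.Finite :=
    ((Set.finite_Iio N).prod (finite_degree_le D)).subset fun _ hq => hq
  obtain ⟨k, hk⟩ := (hfin.eventually_all.2 fun q _ => hc q).exists
  refine ⟨h k, hI k, hD k, fun q hq => ?_⟩
  by_cases hqD : q ∈ degreeLE n D
  · exact hk q ⟨hq, hqD⟩
  · rw [Function.notMem_support.1 fun h' => hqD (hD k h'),
      Function.notMem_support.1 fun h' => hqD (hcD h')]

/-! ### Normal forms -/

/-- The number of monomials in `S` strictly above `q`; the reduction below processes the monomials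
of `S` by increasing rank. -/
def rank (le : Mon n → Mon n → Prop) (S : Set (Mon n)) (q : Mon n) : ℕ :=
  (S ∩ {p | ¬ le p q}).ncard

section NormalForm

variable {le : Mon n → Mon n → Prop} {S : Set (Mon n)} {D : ℕ}

theorem IsTermPreorder.finite_inter_not_le (hle : IsTermPreorder le) (hSD : S ⊆ degreeLE n D)
    (q : Mon n) : (S ∩ {p | ¬ le p q}).Finite :=
  (hle.finite_ge D q).subset fun p hp => ⟨hSD hp.1, (hle.total p q).resolve_left hp.2⟩

theorem IsTermPreorder.rank_anti (hle : IsTermPreorder le) (hSD : S ⊆ degreeLE n D) {p q : Mon n}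
    (h : le p q) : rank le S q ≤ rank le S p :=
  Set.ncard_le_ncard (fun _ hr => ⟨hr.1, fun hrp => hr.2 (hle.trans hrp h)⟩)
    (hle.finite_inter_not_le hSD p)

theorem IsTermPreorder.le_of_rank_eq (hle : IsTermPreorder le) (hSD : S ⊆ degreeLE n D)
    {p q : Mon n} (hq : q ∈ S) (h : rank le S p = rank le S q) : le q p := by
  by_contra hqp
  have hpq : le p q := (hle.total p q).resolve_right hqp
  refine (Set.ncard_lt_ncard ?_ (hle.finite_inter_not_le hSD p)).ne' h
  refine ⟨fun r hr => ⟨hr.1, fun hrp => hr.2 (hle.trans hrp hpq)⟩, fun hss => ?_⟩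
  exact (hss ⟨hq, hqp⟩).2 (hle.refl q)

theorem IsTermOrder.rank_injOn (hle : IsTermOrder le) (hSD : S ⊆ degreeLE n D) :
    Set.InjOn (rank le S) S := fun _ hp _ hq h =>
  hle.antisymm (hle.le_of_rank_eq hSD hp h.symm) (hle.le_of_rank_eq hSD hq h)

variable {I : Ideal (MixedRing R n)}

theorem exists_reduction_at_rank (hle : IsTermOrder le) (hI : IsXHomogeneous I)
    (hSD : S ⊆ degreeLE n D)
    (hS : ∀ p, ∀ q ∈ S, le p q → p.2.degree = q.2.degree → p ∈ S) (f : MixedRing R n) (k : ℕ) :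
    ∃ h ∈ I, (tcoeff h).support ⊆ {p ∈ S | k ≤ rank le S p} ∧
      ∀ q ∈ S, rank le S q = k → term q (tcoeff (f - h) q) ∈ leadIdeal le I →
        tcoeff (f - h) q = 0 := by
  by_cases hex : ∃ q ∈ S, rank le S q = k ∧ term q (tcoeff f q) ∈ leadIdeal le I
  · obtain ⟨q, hq, hqk, hqL⟩ := hex
    obtain ⟨h, hh, hhq, hsupp⟩ := hle.exists_homogeneous_lift hI hqL
    refine ⟨h, hh, fun p hp => ?_, fun q' hq' hk' _ => ?_⟩
    · obtain ⟨hpq, hdeg⟩ := hsupp p hp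
      exact ⟨hS p q hq hpq hdeg, hqk ▸ hle.rank_anti hSD hpq⟩
    · rw [hle.rank_injOn hSD hq' hq (hk'.trans hqk.symm), tcoeff_sub, Pi.sub_apply, hhq, sub_self]
  · refine ⟨0, I.zero_mem, by simp, fun q hq hqk hqL => absurd ⟨q, hq, hqk, ?_⟩ hex⟩
    rwa [sub_zero] at hqL

theorem exists_reduction_sequence (hle : IsTermOrder le) (hI : IsXHomogeneous I)
    (hSD : S ⊆ degreeLE n D)
    (hS : ∀ p, ∀ q ∈ S, le p q → p.2.degree = q.2.degree → p ∈ S) (f : MixedRing R n) :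
    ∃ H : ℕ → MixedRing R n, (∀ k, H k ∈ I) ∧ (∀ k, (tcoeff (H k)).support ⊆ S) ∧
      (∀ q, ∀ k > rank le S q, tcoeff (H k) q = tcoeff (H (rank le S q + 1)) q) ∧
      ∀ q ∈ S, term q (tcoeff (f - H (rank le S q + 1)) q) ∈ leadIdeal le I →
        tcoeff (f - H (rank le S q + 1)) q = 0 := by
  choose step stepI stepS hstep using exists_reduction_at_rank hle hI hSD hS
  let H : ℕ → MixedRing R n := fun k => k.rec 0 fun k g => g + step (f - g) k
  have H_succ (k : ℕ) : H (k + 1) = H k + step (f - H k) k := rfl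
  refine ⟨H, fun k => ?_, fun k => ?_, fun q => ?_, fun q hq => ?_⟩
  · induction k with
    | zero => exact I.zero_mem
    | succ k ih => exact I.add_mem ih (stepI _ k)
  · induction k with
    | zero => simp [H]
    | succ k ih =>
      rw [H_succ, tcoeff_add]
      refine (Function.support_add _ _).trans (Set.union_subset ih ?_)
      exact (stepS _ k).trans (Set.sep_subset _ _)
  · refine Nat.le_induction rfl fun k hk ih => ?_
    have hq : tcoeff (step (f - H k) k) q = 0 :=
      Function.notMem_support.1 fun hq => (stepS _ k hq).2.not_gt hk
    rw [H_succ, tcoeff_add, Pi.add_apply, hq, add_zero, ih]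
  · rw [H_succ, ← sub_sub]
    exact hstep _ _ q hq rfl

theorem exists_normalForm [IsNoetherianRing R] (hle : IsTermOrder le) (hI : IsXHomogeneous I)
    (hSD : S ⊆ degreeLE n D)
    (hS : ∀ p, ∀ q ∈ S, le p q → p.2.degree = q.2.degree → p ∈ S) {f : MixedRing R n}
    (hf : (tcoeff f).support ⊆ S) :
    ∃ h ∈ I, (tcoeff h).support ⊆ S ∧
      ∀ q, term q (tcoeff (f - h) q) ∈ leadIdeal le I → tcoeff (f - h) q = 0 := by
  obtain ⟨H, hHI, hHS, hconst, hred⟩ := exists_reduction_sequence hle hI hSD hS f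
  obtain ⟨h, hhI, hh⟩ := exists_mem_eventually_tcoeff_eq hHI (fun k => (hHS k).trans hSD)
    fun q => ⟨_, Filter.eventually_atTop.2 ⟨_, hconst q⟩⟩
  have hhS : (tcoeff h).support ⊆ S := fun q hq => by
    obtain ⟨k, hk⟩ := (hh q).exists
    exact hHS k (a := q) (by rwa [Function.mem_support, hk])
  refine ⟨h, hhI, hhS, fun q hqL => ?_⟩
  by_cases hq : q ∈ S
  · obtain ⟨k, hk, hk'⟩ := ((hh q).and (Filter.eventually_gt_atTop _)).exists
    have hqH : tcoeff (f - h) q = tcoeff (f - H (rank le S q + 1)) q := by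
      rw [tcoeff_sub, tcoeff_sub, Pi.sub_apply, Pi.sub_apply, ← hk, hconst q k hk']
    rw [hqH] at hqL ⊢
    exact hred q hq hqL
  · rw [tcoeff_sub, Pi.sub_apply, Function.notMem_support.1 fun h' => hq (hf h'),
      Function.notMem_support.1 fun h' => hq (hhS h'), sub_self]

theorem exists_tail_reduced [IsNoetherianRing R] (hle : IsTermOrder le) (hI : IsXHomogeneous I)
    {f : MixedRing R n} (hf : f ∈ I) {m : Mon n} (hm : m ∈ topExps le f) :
    ∃ g ∈ I, m ∈ topExps le g ∧ tcoeff g m = tcoeff f m ∧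
      ∀ q ≠ m, term q (tcoeff g q) ∈ leadIdeal le I → tcoeff g q = 0 := by
  let S : Set (Mon n) := degreeLE n f.totalDegree ∩ {q | ¬ le m q}
  let tail : MixedRing R n := f - mixedTerm m (tcoeff f m)
  have tail_eq {q : Mon n} (hq : q ≠ m) : tcoeff tail q = tcoeff f q := by
    rw [tcoeff_sub, tcoeff_mixedTerm, Pi.sub_apply, Pi.single_eq_of_ne hq, sub_zero]
  have htail : (tcoeff tail).support ⊆ S := fun q hq => by
    have hqm : q ≠ m := by
      rintro rfl
      simp [tail, tcoeff_mixedTerm] at hq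
    rw [Function.mem_support, tail_eq hqm] at hq
    exact ⟨support_tcoeff_subset_degreeLE f hq, fun hmq =>
      hqm (hle.antisymm ((hle.mem_topExps.1 hm).2 q hq) hmq)⟩
  have hSlower : ∀ p, ∀ q ∈ S, le p q → p.2.degree = q.2.degree → p ∈ S :=
    fun p q hq hpq hdeg => ⟨hdeg.trans_le hq.1, fun hmp => hq.2 (hle.trans hmp hpq)⟩
  obtain ⟨h, hhI, hhS, hred⟩ := exists_normalForm hle hI Set.inter_subset_left hSlower htail
  have hgm : tcoeff (f - h) m = tcoeff f m := by
    rw [tcoeff_sub, Pi.sub_apply, sub_eq_self]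
    exact Function.notMem_support.1 fun h' => (hhS h').2 (hle.refl m)
  have hg {q : Mon n} (hq : q ≠ m) : tcoeff (f - h) q = tcoeff (tail - h) q := by
    rw [tcoeff_sub, tcoeff_sub, Pi.sub_apply, Pi.sub_apply, tail_eq hq]
  refine ⟨f - h, I.sub_mem hf hhI, hle.mem_topExps.2 ⟨?_, fun q hq => ?_⟩, hgm, fun q hq => ?_⟩
  · exact hgm ▸ (hle.mem_topExps.1 hm).1
  · by_cases hqm : q = m
    · exact hqm ▸ hle.refl q
    · rw [hg hqm, tcoeff_sub] at hq
      have hqS : q ∈ S := (Function.support_sub _ _ hq).elim (@htail q) (@hhS q)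
      exact (hle.total q m).resolve_right hqS.2
  · rw [hg hq]
    exact hred q

end NormalForm

/-! ### Initially reduced standard bases -/

/-- The condition on a single element `g` in the definition of an initially reduced set: no term of
`g` with exponent in `minExps g`, other than the leading term, lies in `lt_>(H)`. -/
def IsInitiallyReduced (le : Mon n → Mon n → Prop) (H : Set (MixedRing R n)) (g : MixedRing R n) :
    Prop :=
  ∀ p ∈ minExps g, p ∉ topExps le g → term p (tcoeff g p) ∉ leadIdeal le H

theorem IsInitiallyReduced.exists_isHomogeneous {le : Mon n → Mon n → Prop} (hle : IsTermOrder le)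
    {I : Ideal (MixedRing R n)} (hI : IsXHomogeneous I) {g : MixedRing R n} (hg : g ∈ I)
    (hred : IsInitiallyReduced le I g) : ∃ d, g.IsHomogeneous d := by
  rcases eq_or_ne g 0 with rfl | hg0
  · exact ⟨0, MvPolynomial.isHomogeneous_zero _ _ _⟩
  obtain ⟨m, hm⟩ := hle.topExps_nonempty hg0
  refine ⟨m.2.degree, isHomogeneous_of_degree_eq fun q hq => ?_⟩
  by_contra hne
  -- The leading term of the component of degree `q.2.degree` would violate reducedness.
  let g' := MvPolynomial.homogeneousComponent q.2.degree g
  have hg' : g' ≠ 0 := by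
    intro h0
    have hq' := tcoeff_homogeneousComponent q.2.degree g q
    rw [if_pos rfl, show MvPolynomial.homogeneousComponent q.2.degree g = 0 from h0] at hq'
    exact hq (by simpa using hq'.symm)
  obtain ⟨m', hm'⟩ := hle.topExps_nonempty hg'
  have hdeg : m'.2.degree = q.2.degree :=
    degree_eq_of_isHomogeneous (MvPolynomial.homogeneousComponent_isHomogeneous _ g)
      (hle.mem_topExps.1 hm').1
  have hcoeff (b : ℕ) : tcoeff g' (b, m'.2) = tcoeff g (b, m'.2) := by
    rw [tcoeff_homogeneousComponent, if_pos hdeg]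
  have hm'min : m' ∈ minExps g := by
    have := topExps_subset_minExps _ _ hm'
    simp only [mem_minExps, hcoeff] at this ⊢
    exact this
  refine hred m' hm'min (fun h => hne ?_) ?_
  · rw [hle.topExps_eq_singleton hm, Finset.mem_singleton] at h
    rw [← h, hdeg]
  · rw [show tcoeff g m' = tcoeff g' m' from (hcoeff m'.1).symm]
    exact hle.term_mem_leadIdeal (hI.homogeneousComponent_mem hg _) hm'

theorem exists_isInitiallyReduced [IsNoetherianRing R] {le : Mon n → Mon n → Prop}
    (hle : IsTermOrder le) {I : Ideal (MixedRing R n)} (hI : IsXHomogeneous I) {f : MixedRing R n}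
    (hf : f ∈ I) : ∃ g ∈ I, leadTerm le g = leadTerm le f ∧ IsInitiallyReduced le I g := by
  rcases eq_or_ne f 0 with rfl | hf0
  · exact ⟨0, I.zero_mem, rfl, fun p hp =>
      absurd (congrFun tcoeff_zero p) ((mem_minExps 0 p).1 hp).1⟩
  obtain ⟨m, hm⟩ := hle.topExps_nonempty hf0
  obtain ⟨g, hg, hgm, heq, hred⟩ := exists_tail_reduced hle hI hf hm
  refine ⟨g, hg, by rw [hle.leadTerm_eq hgm, hle.leadTerm_eq hm, heq], fun p hp hpm hpI => ?_⟩
  exact ((mem_minExps g p).1 hp).1 (hred p (fun h => hpm (h ▸ hgm)) hpI)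

theorem exists_minimal_finset_span_eq {A M : Type*} [Semiring A] [AddCommMonoid M] [Module A M]
    [IsNoetherian A M] (s : Set M) : ∃ t : Finset M, (t : Set M) ⊆ s ∧
      Submodule.span A (t : Set M) = Submodule.span A s ∧
      ∀ u : Set M, u ⊂ t → Submodule.span A u ≠ Submodule.span A s := by
  obtain ⟨t₀, ht₀, hspan⟩ := (Submodule.fg_span_iff_fg_span_finset_subset s).1
    (IsNoetherian.noetherian (Submodule.span A s))
  obtain ⟨t, -, ⟨hts, ht⟩, hmin⟩ := exists_minimal_le_of_wellFoundedLT
    (fun t : Finset M => (t : Set M) ⊆ s ∧ Submodule.span A (t : Set M) = Submodule.span A s) t₀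
    ⟨ht₀, hspan.symm⟩
  refine ⟨t, hts, ht, fun u hut hu => hut.2 ?_⟩
  lift u to Finset M using t.finite_toSet.subset hut.1
  exact hmin ⟨hut.1.trans hts, hu⟩ hut.1

theorem exists_isInitiallyReducedStandardBasis [IsNoetherianRing R] {le : Mon n → Mon n → Prop}
    (hle : IsTermOrder le) {I : Ideal (MixedRing R n)} (hI : IsXHomogeneous I) :
    ∃ G : Finset (MixedRing R n), IsInitiallyReducedStandardBasis le I G := by
  classical
  obtain ⟨T, hTI, hspan, hmin⟩ :=
    exists_minimal_finset_span_eq (A := PolyRing R n) (leadTerm le '' (I : Set (MixedRing R n)))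
  have hlift : ∀ τ ∈ T, ∃ g ∈ I, leadTerm le g = τ ∧ IsInitiallyReduced le I g := by
    intro τ hτ
    obtain ⟨f, hf, rfl⟩ := hTI hτ
    exact exists_isInitiallyReduced hle hI hf
  choose! g hgI hgT hgred using hlift
  have himage : leadTerm le '' (T.image g : Set (MixedRing R n)) = T := by
    rw [Finset.coe_image, Set.image_image]
    exact (Set.image_congr hgT).trans (Set.image_id' _)
  have hlead : leadIdeal le (T.image g : Set (MixedRing R n)) = leadIdeal le I := by
    rw [leadIdeal, himage]
    exact hspan
  refine ⟨T.image g, ⟨?_, hlead⟩, fun S hS => hmin S (himage ▸ hS), fun x hx => ?_⟩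
  · rw [Finset.coe_image, Set.image_subset_iff]
    exact hgI
  · obtain ⟨τ, hτ, rfl⟩ := Finset.mem_image.1 hx
    rw [hlead]
    exact hgred τ hτ

/-! ### Refining a preorder -/

/-- The monomials that have the same `x`-degree as `m`, are equivalent to `m` for `le`, and are at
most `m` for the refinement `ord` of `le`. -/
def tiesBelow (ord le : Mon n → Mon n → Prop) (m : Mon n) : Set (Mon n) :=
  {q | ord q m ∧ le m q ∧ q.2.degree = m.2.degree}

theorem leadIdeal_mono (le : Mon n → Mon n → Prop) {H H' : Set (MixedRing R n)} (h : H ⊆ H') :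
    leadIdeal le H ≤ leadIdeal le H' :=
  Ideal.span_mono (Set.image_mono h)

theorem leadIdeal_congr {le₁ le₂ : Mon n → Mon n → Prop} {H : Set (MixedRing R n)}
    (h : ∀ g ∈ H, topExps le₁ g = topExps le₂ g) : leadIdeal le₁ H = leadIdeal le₂ H :=
  congrArg Ideal.span (Set.image_congr fun g hg => topForm_eq_iff.2 (h g hg))

section Refinement

variable {ord le : Mon n → Mon n → Prop} (hord : IsTermOrder ord) (hle : IsTermPreorder le)
  (href : ∀ {p q}, ord p q → le p q)

include hord hle

theorem add_mem_tiesBelow {m q : Mon n} (hq : q ∈ tiesBelow ord le m) (u : Mon n) :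
    q + u ∈ tiesBelow ord le (m + u) := by
  obtain ⟨h₁, h₂, h₃⟩ := hq
  exact ⟨(hord.add_iff _ _ _).2 h₁, (hle.add_iff _ _ _).2 h₂, by
    rw [Prod.snd_add, Prod.snd_add, map_add, map_add, h₃]⟩

theorem topExps_subset_tiesBelow {g : MixedRing R n} {d : ℕ} (hg : g.IsHomogeneous d) {m : Mon n}
    (hm : m ∈ topExps ord g) : (topExps le g : Set (Mon n)) ⊆ tiesBelow ord le m := fun q hq => by
  rw [hord.mem_topExps] at hm
  rw [Finset.mem_coe, hle.mem_topExps] at hq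
  exact ⟨hm.2 q hq.1, hq.2 m hm.1,
    (degree_eq_of_isHomogeneous hg hq.1).trans (degree_eq_of_isHomogeneous hg hm.1).symm⟩

include href

theorem topExps_subset_of_refines (f : MixedRing R n) : topExps ord f ⊆ topExps le f := fun _ hp =>
  hle.mem_topExps.2 ((hord.mem_topExps.1 hp).imp_right fun h q hq => href (h q hq))

theorem term_mem_leadIdeal_of_greatest {I : Ideal (MixedRing R n)} {p : PolyRing R n}
    (hp : p ∈ leadIdeal le (I : Set (MixedRing R n))) {m : Mon n}
    (hm : ∀ q, pcoeff p q ≠ 0 → ord q m) :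
    term m (pcoeff p m) ∈ leadIdeal ord (I : Set (MixedRing R n)) := by
  rcases eq_or_ne (pcoeff p m) 0 with h0 | h0
  · rw [h0, term_zero]
    exact Ideal.zero_mem _
  obtain ⟨f, hf, hfp⟩ := hle.exists_isLift hp m
  rw [← hfp.tcoeff_eq m (hle.refl m) (hle.refl m)] at h0 ⊢
  refine hord.term_mem_leadIdeal hf (hord.mem_topExps.2 ⟨h0, fun q hq => ?_⟩)
  have hqm := hfp.le_of_ne_zero q hq
  by_cases hmq : le m q
  · rw [hfp.tcoeff_eq q hqm hmq] at hq
    exact hm q hq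
  · exact (hord.total q m).resolve_right fun h => hmq (href h)

theorem exists_mem_leadIdeal_pcoeff_eq {G : Set (MixedRing R n)}
    (hG : ∀ g ∈ G, ∃ d, g.IsHomogeneous d) {p : PolyRing R n} (hp : p ∈ leadIdeal ord G)
    (m : Mon n) :
    ∃ k ∈ leadIdeal le G, pcoeff k m = pcoeff p m ∧ (pcoeff k).support ⊆ tiesBelow ord le m := by
  induction hp using span_term_induction generalizing m with
  | mem τ hτ =>
    obtain ⟨g, hg, rfl⟩ := hτ
    by_cases hm : m ∈ topExps ord g
    · have hm' := topExps_subset_of_refines hord hle href g hm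
      obtain ⟨d, hd⟩ := hG g hg
      refine ⟨topForm le g, Ideal.subset_span ⟨g, hg, rfl⟩, ?_, ?_⟩
      · rw [leadTerm, pcoeff_topForm_of_mem hm, pcoeff_topForm_of_mem hm']
      · rw [support_pcoeff_topForm]
        exact topExps_subset_tiesBelow hord hle hd hm
    · refine ⟨0, Ideal.zero_mem _, ?_, by simp⟩
      rw [leadTerm, pcoeff_topForm_of_notMem hm, map_zero, Pi.zero_apply]
  | zero => exact ⟨0, Ideal.zero_mem _, rfl, by simp⟩
  | add a b _ _ iha ihb =>
    obtain ⟨k, hk, hka, hks⟩ := iha m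
    obtain ⟨l, hl, hlb, hls⟩ := ihb m
    refine ⟨k + l, Ideal.add_mem _ hk hl, by simp [hka, hlb], ?_⟩
    rw [map_add]
    exact (Function.support_add _ _).trans (Set.union_subset hks hls)
  | term_mul u c x _ ih =>
    by_cases hu : u ≤ m
    · obtain ⟨k, hk, hkx, hks⟩ := ih (m - u)
      refine ⟨term u c * k, Ideal.mul_mem_left _ _ hk, by simp [pcoeff_term_mul, hkx], ?_⟩
      intro q hq
      rw [Function.mem_support, pcoeff_term_mul] at hq
      obtain ⟨huq, hq⟩ := ite_ne_right_iff.1 hq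
      rw [← tsub_add_cancel_of_le huq, ← tsub_add_cancel_of_le hu]
      exact add_mem_tiesBelow hord hle (hks (right_ne_zero_of_mul hq)) u
    · exact ⟨0, Ideal.zero_mem _, by simp [pcoeff_term_mul, hu], by simp⟩

theorem mem_leadIdeal_of_support_subset {I : Ideal (MixedRing R n)} {G : Set (MixedRing R n)}
    (hGI : G ⊆ I) (hG : ∀ g ∈ G, ∃ d, g.IsHomogeneous d)
    (hlead : leadIdeal ord G = leadIdeal ord I) {T : Finset (Mon n)}
    (hT : ∀ q ∈ T, tiesBelow ord le q ⊆ T) {p : PolyRing R n} (hp : p ∈ leadIdeal le I)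
    (hpT : (pcoeff p).support ⊆ T) : p ∈ leadIdeal le G := by
  classical
  induction T using Finset.strongInduction generalizing p with
  | H T ih =>
  rcases eq_or_ne p 0 with rfl | hp0
  · exact Ideal.zero_mem _
  obtain ⟨m, hm, hmax⟩ := hord.exists_greatest_of_ne_zero hp0
  have hterm := term_mem_leadIdeal_of_greatest hord hle href hp hmax
  rw [← hlead] at hterm
  obtain ⟨k, hk, hkm, hkties⟩ := exists_mem_leadIdeal_pcoeff_eq hord hle href hG hterm m
  rw [pcoeff_term, Pi.single_eq_same] at hkm
  have hpk : (pcoeff (p - k)).support ⊆ T.filter fun q => ord q m ∧ q ≠ m := fun q hq => by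
    have hqm : q ≠ m := by
      rintro rfl
      simp [hkm] at hq
    rw [map_sub] at hq
    rw [Finset.coe_filter]
    rcases Function.support_sub _ _ hq with h | h
    · exact ⟨hpT h, hmax q h, hqm⟩
    · exact ⟨hT m (hpT hm) (hkties h), (hkties h).1, hqm⟩
  rw [← sub_add_cancel p k]
  refine Ideal.add_mem _ (ih _ (Finset.filter_ssubset.2 ⟨m, hpT hm, fun h => h.2 rfl⟩) ?_
    (Ideal.sub_mem _ hp (leadIdeal_mono le hGI hk)) hpk) hk
  intro q hq r hr
  obtain ⟨hqT, hqm, hne⟩ := Finset.mem_filter.1 hq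
  refine Finset.mem_coe.2 (Finset.mem_filter.2 ⟨hT q hqT hr, hord.trans hr.1 hqm, ?_⟩)
  rintro rfl
  exact hne (hord.antisymm hqm hr.1)

theorem leadIdeal_eq_of_refines {I : Ideal (MixedRing R n)} {G : Set (MixedRing R n)}
    (hGI : G ⊆ I) (hG : ∀ g ∈ G, ∃ d, g.IsHomogeneous d)
    (hlead : leadIdeal ord G = leadIdeal ord I) : leadIdeal le G = leadIdeal le I := by
  refine le_antisymm (leadIdeal_mono le hGI) fun p hp => ?_
  let T : Set (Mon n) := ⋃ q ∈ (pcoeff p).support, {r | le q r ∧ r.2.degree = q.2.degree}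
  have hTfin : T.Finite := (finite_support_pcoeff p).biUnion fun q _ =>
    (hle.finite_ge q.2.degree q).subset fun r hr => ⟨hr.2.le, hr.1⟩
  refine mem_leadIdeal_of_support_subset hord hle href hGI hG hlead (T := hTfin.toFinset) ?_ hp ?_
  · intro q hq r hr
    rw [hTfin.mem_toFinset, Set.mem_iUnion₂] at hq
    obtain ⟨s, hs, hsq, hdeg⟩ := hq
    rw [hTfin.coe_toFinset]
    exact Set.mem_iUnion₂.2 ⟨s, hs, hle.trans hsq hr.2.1, hr.2.2.trans hdeg⟩
  · intro q hq
    rw [hTfin.coe_toFinset]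
    exact Set.mem_iUnion₂.2 ⟨q, hq, hle.refl q, rfl⟩

theorem IsInitiallyReduced.exists_mem_topExps {I : Ideal (MixedRing R n)} {g : MixedRing R n}
    (hred : IsInitiallyReduced ord I g) {p : PolyRing R n}
    (hp : p ∈ leadIdeal le (I : Set (MixedRing R n))) (hp0 : p ≠ 0)
    (hpg : ∀ q, pcoeff p q ≠ 0 → q ∈ minExps g ∧ pcoeff p q ∣ tcoeff g q) :
    ∃ m ∈ topExps ord g, pcoeff p m ≠ 0 := by
  obtain ⟨m, hm, hmax⟩ := hord.exists_greatest_of_ne_zero hp0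
  refine ⟨m, by_contra fun hmg => ?_, hm⟩
  obtain ⟨hmin, c, hc⟩ := hpg m hm
  refine hred m hmin hmg ?_
  have hterm : term m (tcoeff g m) = term m (pcoeff p m) * term 0 c := by
    rw [term_mul_term, add_zero, hc]
  rw [hterm]
  exact Ideal.mul_mem_right _ _ (term_mem_leadIdeal_of_greatest hord hle href hp hmax)

theorem IsInitiallyReduced.topExps_eq {le' : Mon n → Mon n → Prop} (hle' : IsTermPreorder le')
    {I : Ideal (MixedRing R n)} (heq : leadIdeal le' (I : Set (MixedRing R n)) = leadIdeal le I)
    {g : MixedRing R n} (hg : g ∈ I) (hred : IsInitiallyReduced ord I g) :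
    topExps le' g = topExps le g := by
  rcases eq_or_ne g 0 with rfl | hg0
  · rfl
  have hmem : topForm le g ∈ leadIdeal le (I : Set (MixedRing R n)) :=
    Ideal.subset_span ⟨g, hg, rfl⟩
  have hmem' : topForm le' g ∈ leadIdeal le (I : Set (MixedRing R n)) :=
    heq ▸ Ideal.subset_span ⟨g, hg, rfl⟩
  obtain ⟨m, hm, hmne⟩ := hred.exists_mem_topExps hord hle href hmem' (hle'.topForm_ne_zero hg0)
    fun q hq => by
      have hq' := not_imp_comm.1 pcoeff_topForm_of_notMem hq
      exact ⟨topExps_subset_minExps le' g hq', (pcoeff_topForm_of_mem hq').dvd⟩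
  have hm' := not_imp_comm.1 pcoeff_topForm_of_notMem hmne
  refine topForm_eq_iff.1 (sub_eq_zero.1 (by_contra fun hne => ?_))
  obtain ⟨q, hq, hqne⟩ := hred.exists_mem_topExps hord hle href (Ideal.sub_mem _ hmem' hmem) hne
    fun q hq => by
      rw [map_sub, Pi.sub_apply] at hq ⊢
      by_cases h' : q ∈ topExps le' g <;> by_cases h : q ∈ topExps le g
      · simp [pcoeff_topForm_of_mem h', pcoeff_topForm_of_mem h] at hq
      · exact ⟨topExps_subset_minExps le' g h', by
          simp [pcoeff_topForm_of_mem h', pcoeff_topForm_of_notMem h]⟩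
      · exact ⟨topExps_subset_minExps le g h, by
          simp [pcoeff_topForm_of_notMem h', pcoeff_topForm_of_mem h]⟩
      · simp [pcoeff_topForm_of_notMem h', pcoeff_topForm_of_notMem h] at hq
  rw [hord.topExps_eq_singleton hm, Finset.mem_singleton] at hq
  subst hq
  have hm := topExps_subset_of_refines hord hle href g hm
  simp [pcoeff_topForm_of_mem hm', pcoeff_topForm_of_mem hm] at hqne

end Refinement

theorem leadIdeal_eq_of_le [IsNoetherianRing R] {le₁ le₂ : Mon n → Mon n → Prop}
    (hle₁ : IsTermOrder le₁) (hle₂ : IsTermOrder le₂) {I : Ideal (MixedRing R n)}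
    (hI : IsXHomogeneous I) (h : leadIdeal le₁ (I : Set (MixedRing R n)) ≤ leadIdeal le₂ I) :
    leadIdeal le₁ (I : Set (MixedRing R n)) = leadIdeal le₂ I := by
  refine le_antisymm h (Ideal.span_le.2 ?_)
  rintro _ ⟨f, hf, rfl⟩
  rcases eq_or_ne f 0 with rfl | hf0
  · simp [leadTerm]
  obtain ⟨m, hm⟩ := hle₂.topExps_nonempty hf0
  obtain ⟨g, hg, hgm, heq, hred⟩ := exists_tail_reduced hle₂ hI hf hm
  have hg0 : g ≠ 0 := by
    rintro rfl
    exact (hle₂.mem_topExps.1 hgm).1 (congrFun tcoeff_zero m)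
  obtain ⟨q, hq⟩ := hle₁.topExps_nonempty hg0
  have hqI := hle₁.term_mem_leadIdeal hg hq
  have hqm : q = m := by_contra fun hne => (hle₁.mem_topExps.1 hq).1 (hred q hne (h hqI))
  rw [hle₂.leadTerm_eq hm, ← heq]
  exact hqm ▸ hqI

/-! ### Weights -/

theorem wdeg_add (w : Weight n) (p q : Mon n) : wdeg w (p + q) = wdeg w p + wdeg w q := by
  simp only [wdeg, Prod.fst_add, Prod.snd_add, Finsupp.add_apply, Nat.cast_add, mul_add,
    Finset.sum_add_distrib]
  ring

theorem wdeg_add_smul (v w : Weight n) (ε : ℝ) (p : Mon n) :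
    wdeg (v + ε • w) p = wdeg v p + ε * wdeg w p := by
  simp only [wdeg, Prod.fst_add, Prod.smul_fst, smul_eq_mul, Prod.snd_add, Prod.smul_snd,
    Pi.add_apply, Pi.smul_apply, add_mul, Finset.sum_add_distrib, mul_add, Finset.mul_sum,
    mul_assoc]
  ring

variable {v w : Weight n} {le : Mon n → Mon n → Prop}

theorem finite_degreeLE_inter_weightLe (hw : w.1 < 0) (D : ℕ) (q : Mon n) :
    (degreeLE n D ∩ {p | weightLe w q p}).Finite := by
  have hfiber (α : Fin n →₀ ℕ) : {p : Mon n | p.2 = α ∧ weightLe w q p}.Finite := by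
    obtain ⟨N, hN⟩ := exists_nat_gt ((wdeg w q - ∑ i, w.2 i * (α i : ℝ)) / w.1)
    refine ((Set.finite_Iio N).prod (Set.finite_singleton α)).subset ?_
    rintro ⟨b, a⟩ ⟨rfl, h⟩
    have hb : (b : ℝ) ≤ (wdeg w q - ∑ i, w.2 i * (a i : ℝ)) / w.1 := by
      rw [le_div_iff_of_neg hw, sub_le_iff_le_add, mul_comm]
      exact h
    exact ⟨by exact_mod_cast hb.trans_lt hN, rfl⟩
  refine ((finite_degree_le (n := n) D).biUnion fun α _ => hfiber α).subset fun p hp => ?_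
  exact Set.mem_biUnion hp.1 ⟨rfl, hp.2⟩

theorem isTermPreorder_weightLe (hw : w.1 < 0) : IsTermPreorder (weightLe w) where
  trans := le_trans (α := ℝ)
  total _ _ := le_total (α := ℝ) _ _
  add_iff a b c := by simp [weightLe, wdeg_add]
  finite_ge := finite_degreeLE_inter_weightLe hw

theorem weightedOrder_iff {a b : Mon n} :
    weightedOrder w le a b ↔ wdeg w a ≤ wdeg w b ∧ (wdeg w a = wdeg w b → le a b) := by
  rw [weightedOrder, le_iff_lt_or_eq]
  grind

theorem weightLe_of_weightedOrder {a b : Mon n} (h : weightedOrder w le a b) : weightLe w a b :=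
  (weightedOrder_iff.1 h).1

theorem IsMonomialOrdering.add_iff (hle : IsMonomialOrdering le) (a b c : Mon n) :
    le (a + c) (b + c) ↔ le a b := by
  refine ⟨fun h => (hle.total a b).elim id fun h' => ?_, hle.add_right a b c⟩
  rw [add_right_cancel (hle.antisymm _ _ h (hle.add_right _ _ c h'))]
  exact hle.refl b

theorem isTermOrder_weightedOrder (hw : w.1 < 0) (hle : IsMonomialOrdering le) :
    IsTermOrder (weightedOrder w le) where
  trans {a b c} hab hbc := by
    rw [weightedOrder_iff] at *
    refine ⟨hab.1.trans hbc.1, fun hac => hle.trans a b c (hab.2 ?_) (hbc.2 ?_)⟩ <;> linarith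
  total a b := by
    rcases lt_trichotomy (wdeg w a) (wdeg w b) with h | h | h
    · exact Or.inl (Or.inl h)
    · exact (hle.total a b).imp (fun h' => Or.inr ⟨h, h'⟩) fun h' => Or.inr ⟨h.symm, h'⟩
    · exact Or.inr (Or.inl h)
  add_iff a b c := by simp [weightedOrder, wdeg_add, hle.add_iff]
  finite_ge D q := (finite_degreeLE_inter_weightLe hw D q).subset
    (Set.inter_subset_inter_right _ fun _ => weightLe_of_weightedOrder)
  antisymm {a b} hab hba := by
    rw [weightedOrder_iff] at hab hba
    have h := hab.1.antisymm hba.1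
    exact hle.antisymm a b (hab.2 h) (hba.2 h.symm)

theorem wdeg_eq_of_mem_topExps (hw : w.1 < 0) {f : MixedRing R n} {p q : Mon n}
    (hp : p ∈ topExps (weightLe w) f) (hq : q ∈ topExps (weightLe w) f) : wdeg w p = wdeg w q := by
  rw [(isTermPreorder_weightLe hw).mem_topExps] at hp hq
  exact le_antisymm (hq.2 p hp.1) (hp.2 q hq.1)

section Recognition

variable (hw : w.1 < 0) (hle : IsMonomialOrdering le)

include hw hle

theorem topExps_weightedOrder_subset (f : MixedRing R n) :
    topExps (weightedOrder w le) f ⊆ topExps (weightLe w) f :=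
  topExps_subset_of_refines (isTermOrder_weightedOrder hw hle) (isTermPreorder_weightLe hw)
    weightLe_of_weightedOrder f

theorem mem_topExps_weightedOrder {f : MixedRing R n} {m : Mon n} :
    m ∈ topExps (weightedOrder w le) f ↔
      m ∈ topExps (weightLe w) f ∧ ∀ q ∈ topExps (weightLe w) f, le q m := by
  have hpre := isTermPreorder_weightLe hw
  have hord := isTermOrder_weightedOrder hw hle
  refine ⟨fun hm => ?_, fun ⟨hm, hmax⟩ => ?_⟩
  · have hm' := topExps_weightedOrder_subset hw hle f hm
    refine ⟨hm', fun q hq => ?_⟩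
    exact (weightedOrder_iff.1 ((hord.mem_topExps.1 hm).2 q (hpre.mem_topExps.1 hq).1)).2
      (wdeg_eq_of_mem_topExps hw hq hm')
  · obtain ⟨hm0, hmax'⟩ := hpre.mem_topExps.1 hm
    refine hord.mem_topExps.2 ⟨hm0, fun q hq => weightedOrder_iff.2 ⟨hmax' q hq, fun heq => ?_⟩⟩
    exact hmax q (hpre.mem_topExps.2 ⟨hq, fun r hr => (hmax' r hr).trans heq.ge⟩)

theorem leadIdeal_eq_of_topExps_eq [IsNoetherianRing R] (hv : v.1 < 0) {I : Ideal (MixedRing R n)}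
    (hI : IsXHomogeneous I) {G : Finset (MixedRing R n)}
    (hG : IsStandardBasis (weightedOrder w le) I G)
    (htop : ∀ g ∈ G, topExps (weightLe v) g = topExps (weightLe w) g) :
    leadIdeal (weightedOrder v le) (G : Set (MixedRing R n)) =
      leadIdeal (weightedOrder v le) I := by
  have hGvw : leadIdeal (weightedOrder v le) (G : Set (MixedRing R n)) =
      leadIdeal (weightedOrder w le) I := by
    rw [← hG.2]
    refine leadIdeal_congr fun g hg => Finset.ext fun m => ?_
    rw [mem_topExps_weightedOrder hv hle, mem_topExps_weightedOrder hw hle, htop g hg]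
  rw [hGvw]
  exact leadIdeal_eq_of_le (isTermOrder_weightedOrder hw hle) (isTermOrder_weightedOrder hv hle) hI
    (hGvw ▸ leadIdeal_mono _ hG.1)

theorem initialIdeal_eq_iff [IsNoetherianRing R] (hv : v.1 < 0) {I : Ideal (MixedRing R n)}
    (hI : IsXHomogeneous I) {G : Finset (MixedRing R n)}
    (hG : IsStandardBasis (weightedOrder w le) I G)
    (hred : IsInitiallyReducedWrt (weightedOrder w le) G G) :
    initialIdeal v I = initialIdeal w I ↔
      ∀ g ∈ G, topExps (weightLe v) g = topExps (weightLe w) g := by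
  have hW := isTermOrder_weightedOrder hw hle
  have hredI : ∀ g ∈ G, IsInitiallyReduced (weightedOrder w le) I g := fun g hg p => by
    rw [← hG.2]
    exact hred g hg p
  have hhom : ∀ g ∈ (G : Set (MixedRing R n)), ∃ d, g.IsHomogeneous d := fun g hg =>
    (hredI g hg).exists_isHomogeneous hW hI (hG.1 hg)
  refine ⟨fun h g hg => (hredI g hg).topExps_eq hW (isTermPreorder_weightLe hw)
    weightLe_of_weightedOrder (isTermPreorder_weightLe hv) h (hG.1 hg), fun h => ?_⟩
  calc initialIdeal v I
      = leadIdeal (weightLe v) (G : Set (MixedRing R n)) :=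
        (leadIdeal_eq_of_refines (isTermOrder_weightedOrder hv hle) (isTermPreorder_weightLe hv)
          weightLe_of_weightedOrder hG.1 hhom
          (leadIdeal_eq_of_topExps_eq hw hle hv hI hG h)).symm
    _ = leadIdeal (weightLe w) (G : Set (MixedRing R n)) := leadIdeal_congr h
    _ = initialIdeal w I :=
        leadIdeal_eq_of_refines hW (isTermPreorder_weightLe hw) weightLe_of_weightedOrder hG.1 hhom
          hG.2

end Recognition

/-! ### Rational polyhedral cones -/

theorem IsRationalPolyhedralCone.isClosed {C : Set (Weight n)} (h : IsRationalPolyhedralCone C) :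
    IsClosed C := by
  obtain ⟨A, rfl⟩ := h
  simp only [Set.ofPred_forall]
  exact isClosed_biInter fun a _ => isClosed_le continuous_const (by fun_prop)

theorem IsRationalPolyhedralCone.inter {C C' : Set (Weight n)} (h : IsRationalPolyhedralCone C)
    (h' : IsRationalPolyhedralCone C') : IsRationalPolyhedralCone (C ∩ C') := by
  classical
  obtain ⟨A, rfl⟩ := h
  obtain ⟨A', rfl⟩ := h'
  refine ⟨A ∪ A', Set.ext fun v => ?_⟩
  simp only [Set.mem_inter_iff, Set.mem_ofPred_eq, Finset.mem_union, or_imp, forall_and]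

theorem isRationalPolyhedralCone_forall_mem {ι : Type*} (s : Finset ι)
    {P : ι → Weight n → Prop} (h : ∀ i ∈ s, IsRationalPolyhedralCone {v | P i v}) :
    IsRationalPolyhedralCone {v | ∀ i ∈ s, P i v} := by
  classical
  choose! A hA using h
  refine ⟨s.biUnion A, Set.ext fun v => ?_⟩
  have hiff : ∀ i ∈ s, (P i v ↔ ∀ a ∈ A i, 0 ≤ v.1 * (a.1 : ℝ) + ∑ j, v.2 j * (a.2 j : ℝ)) :=
    fun i hi => Set.ext_iff.1 (hA i hi) v
  simp only [Set.mem_ofPred_eq, Finset.mem_biUnion]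
  exact (forall₂_congr hiff).trans
    ⟨fun h a ⟨i, hi, ha⟩ => h i hi a ha, fun h i hi a ha => h a ⟨i, hi, ha⟩⟩

theorem isRationalPolyhedralCone_halfspace (a : ℤ × (Fin n → ℤ)) :
    IsRationalPolyhedralCone {v : Weight n | 0 ≤ v.1 * (a.1 : ℝ) + ∑ i, v.2 i * (a.2 i : ℝ)} :=
  ⟨{a}, by simp⟩

theorem isRationalPolyhedralCone_fst_nonpos :
    IsRationalPolyhedralCone {v : Weight n | v.1 ≤ 0} := by
  simpa using isRationalPolyhedralCone_halfspace (n := n) (-1, 0)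

theorem isRationalPolyhedralCone_fst_eq_zero :
    IsRationalPolyhedralCone {v : Weight n | v.1 = 0} := by
  have hnonneg : IsRationalPolyhedralCone {v : Weight n | 0 ≤ v.1} := by
    simpa using isRationalPolyhedralCone_halfspace (n := n) (1, 0)
  simpa only [← Set.ofPred_and, le_antisymm_iff] using
    isRationalPolyhedralCone_fst_nonpos.inter hnonneg

theorem isRationalPolyhedralCone_wdeg_le (p q : Mon n) :
    IsRationalPolyhedralCone {v : Weight n | wdeg v p ≤ wdeg v q} := by
  convert! isRationalPolyhedralCone_halfspace ((q.1 - p.1 : ℤ), fun i => (q.2 i - p.2 i : ℤ))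
    using 1
  ext v
  simp only [Set.mem_ofPred_eq, wdeg, Int.cast_sub, Int.cast_natCast, mul_sub,
    Finset.sum_sub_distrib]
  constructor <;> intro h <;> linarith

theorem isRationalPolyhedralCone_wdeg_eq (p q : Mon n) :
    IsRationalPolyhedralCone {v : Weight n | wdeg v p = wdeg v q} := by
  simpa only [← Set.ofPred_and, le_antisymm_iff] using
    (isRationalPolyhedralCone_wdeg_le p q).inter (isRationalPolyhedralCone_wdeg_le q p)

theorem isRationalPolyhedralCone_satisfiesSystem (w : Weight n) (le : Mon n → Mon n → Prop)
    (G : Finset (MixedRing R n)) : IsRationalPolyhedralCone {v | SatisfiesSystem w le G v} := by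
  refine isRationalPolyhedralCone_forall_mem G fun g _ => IsRationalPolyhedralCone.inter ?_ ?_
  · exact isRationalPolyhedralCone_forall_mem _ fun m _ =>
      isRationalPolyhedralCone_forall_mem _ fun p _ => isRationalPolyhedralCone_wdeg_le p m
  · exact isRationalPolyhedralCone_forall_mem _ fun p _ =>
      isRationalPolyhedralCone_forall_mem _ fun q _ => isRationalPolyhedralCone_wdeg_eq p q

/-! ### Gröbner cones -/

theorem fst_add_smul_neg (hv : v.1 ≤ 0) (hw : w.1 < 0) {ε : ℝ} (hε : 0 < ε) :
    (v + ε • w).1 < 0 :=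
  add_neg_of_nonpos_of_neg hv (mul_neg_of_pos_of_neg hε hw)

theorem satisfiesSystem_of_topExps_eq (hv : v.1 < 0) (hw : w.1 < 0) (hle : IsMonomialOrdering le)
    {G : Finset (MixedRing R n)} (h : ∀ g ∈ G, topExps (weightLe v) g = topExps (weightLe w) g) :
    SatisfiesSystem w le G v := by
  refine fun g hg => ⟨fun m hm p hp => ?_, fun p hp q hq => ?_⟩
  · have hm' := topExps_weightedOrder_subset hw hle g hm
    rw [← h g hg, (isTermPreorder_weightLe hv).mem_topExps_iff_minExps] at hm'
    exact hm'.2 p hp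
  · rw [← h g hg] at hp hq
    exact wdeg_eq_of_mem_topExps hv hp hq

theorem topExps_add_smul (hv : v.1 ≤ 0) (hw : w.1 < 0) (hle : IsMonomialOrdering le)
    {G : Finset (MixedRing R n)} (h : SatisfiesSystem w le G v) {ε : ℝ} (hε : 0 < ε)
    {g : MixedRing R n} (hg : g ∈ G) :
    topExps (weightLe (v + ε • w)) g = topExps (weightLe w) g := by
  rcases eq_or_ne g 0 with rfl | hg0
  · rfl
  have hpre := isTermPreorder_weightLe (fst_add_smul_neg hv hw hε)
  have hprew := isTermPreorder_weightLe hw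
  obtain ⟨m, hm⟩ := (isTermOrder_weightedOrder hw hle).topExps_nonempty hg0
  obtain ⟨hmax, hties⟩ := h g hg
  have hmw := topExps_weightedOrder_subset hw hle g hm
  obtain ⟨hm0, hmaxw⟩ := hprew.mem_topExps_iff_minExps.1 hmw
  have hmvw : m ∈ topExps (weightLe (v + ε • w)) g := by
    refine hpre.mem_topExps_iff_minExps.2 ⟨hm0, fun p hp => ?_⟩
    simp only [weightLe, wdeg_add_smul]
    exact add_le_add (hmax m hm p hp) (mul_le_mul_of_nonneg_left (hmaxw p hp) hε.le)
  ext p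
  rw [hpre.mem_topExps_iff_of_mem hmvw, hprew.mem_topExps_iff_of_mem hmw]
  refine and_congr_right fun hp => ?_
  simp only [weightLe, wdeg_add_smul]
  refine ⟨fun hmp => ?_, fun hmp => ?_⟩
  · have := hmax m hm p hp
    exact le_of_mul_le_mul_left (by linarith) hε
  · have hpw := (hprew.mem_topExps_iff_of_mem hmw).2 ⟨hp, hmp⟩
    exact add_le_add (hties m hmw p hpw).le (mul_le_mul_of_nonneg_left hmp hε.le)

theorem groebnerCone_eq [IsNoetherianRing R] (hw : w.1 < 0) (hle : IsMonomialOrdering le)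
    {I : Ideal (MixedRing R n)} (hI : IsXHomogeneous I) {G : Finset (MixedRing R n)}
    (hG : IsStandardBasis (weightedOrder w le) I G)
    (hred : IsInitiallyReducedWrt (weightedOrder w le) G G) :
    groebnerCone I w = {v | v.1 ≤ 0 ∧ SatisfiesSystem w le G v} := by
  refine Set.Subset.antisymm (closure_minimal ?_ ?_) ?_
  · rintro v ⟨hv, heq⟩
    exact ⟨hv.le, satisfiesSystem_of_topExps_eq hv hw hle
      ((initialIdeal_eq_iff hw hle hv hI hG hred).1 heq)⟩
  · exact (isRationalPolyhedralCone_fst_nonpos.inter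
      (isRationalPolyhedralCone_satisfiesSystem w le G)).isClosed
  · rintro v ⟨hv, hsys⟩
    have hlim : Filter.Tendsto (fun ε : ℝ => v + ε • w) (nhdsWithin 0 (Set.Ioi 0)) (nhds v) := by
      have hcont : Continuous fun ε : ℝ => v + ε • w := by fun_prop
      simpa using (hcont.tendsto 0).mono_left nhdsWithin_le_nhds
    refine mem_closure_of_tendsto hlim ?_
    filter_upwards [self_mem_nhdsWithin] with ε hε
    have hvw := fst_add_smul_neg hv hw hε
    exact ⟨hvw, (initialIdeal_eq_iff hw hle hvw hI hG hred).2 fun g hg =>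
      topExps_add_smul hv hw hle hsys hε hg⟩

theorem boundaryGroebnerCone_eq [IsNoetherianRing R] (hw : w.1 < 0) (hle : IsMonomialOrdering le)
    {I : Ideal (MixedRing R n)} (hI : IsXHomogeneous I) {G : Finset (MixedRing R n)}
    (hG : IsStandardBasis (weightedOrder w le) I G)
    (hred : IsInitiallyReducedWrt (weightedOrder w le) G G) :
    boundaryGroebnerCone I w = {v | v.1 = 0 ∧ SatisfiesSystem w le G v} := by
  rw [boundaryGroebnerCone, groebnerCone_eq hw hle hI hG hred]
  ext v
  exact ⟨fun h => ⟨h.2, h.1.2⟩, fun h => ⟨⟨h.1.le, h.2⟩, h.1⟩⟩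

theorem exists_isMonomialOrdering (n : ℕ) :
    ∃ le : Mon n → Mon n → Prop, IsMonomialOrdering le := by
  let e (p : Mon n) : ℕ ×ₗ MonomialOrder.lex.syn :=
    toLex (p.1, MonomialOrder.lex.toSyn (σ := Fin n) p.2)
  have e_add (p q : Mon n) : e (p + q) = e p + e q := by simp [e, ← toLex_add]
  have e_injective : Function.Injective e := fun p q h => by simpa [e, Prod.ext_iff] using h
  exact ⟨fun p q => e p ≤ e q,
    { refl := fun _ => le_rfl
      trans := fun _ _ _ => le_trans
      antisymm := fun _ _ h h' => e_injective (le_antisymm h h')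
      total := fun _ _ => le_total _ _
      add_right := fun a b c h => by simpa only [e_add] using add_le_add_left h (e c) }⟩

theorem proposition3p14_general [IsNoetherianRing R]
    (I : Ideal (MixedRing R n)) (hI : IsXHomogeneous I) (w : Weight n) (hw : w.1 < 0) :
    (IsClosed (groebnerCone I w) ∧ IsRationalPolyhedralCone (groebnerCone I w)) ∧
    (IsClosed (boundaryGroebnerCone I w) ∧ IsRationalPolyhedralCone (boundaryGroebnerCone I w)) ∧
    ∀ le : Mon n → Mon n → Prop, IsMonomialOrdering le →
      (∃ G : Finset (MixedRing R n),
        IsInitiallyReducedStandardBasis (weightedOrder w le) I G) ∧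
      ∀ G : Finset (MixedRing R n),
        IsStandardBasis (weightedOrder w le) I G →
        IsInitiallyReducedWrt (weightedOrder w le) G G →
        groebnerCone I w = {v | v.1 ≤ 0 ∧ SatisfiesSystem w le G v} ∧
        boundaryGroebnerCone I w = {v | v.1 = 0 ∧ SatisfiesSystem w le G v} := by
  have hbasis (le : Mon n → Mon n → Prop) (hle : IsMonomialOrdering le) :=
    exists_isInitiallyReducedStandardBasis (isTermOrder_weightedOrder hw hle) hI
  have hcone : IsRationalPolyhedralCone (groebnerCone I w) := by
    obtain ⟨le, hle⟩ := exists_isMonomialOrdering n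
    obtain ⟨G, hG, -, hred⟩ := hbasis le hle
    rw [groebnerCone_eq hw hle hI hG hred]
    exact isRationalPolyhedralCone_fst_nonpos.inter
      (isRationalPolyhedralCone_satisfiesSystem w le G)
  have hcone' : IsRationalPolyhedralCone (boundaryGroebnerCone I w) :=
    hcone.inter isRationalPolyhedralCone_fst_eq_zero
  exact ⟨⟨hcone.isClosed, hcone⟩, ⟨hcone'.isClosed, hcone'⟩, fun le hle => ⟨hbasis le hle,
    fun G hG hred => ⟨groebnerCone_eq hw hle hI hG hred,
      boundaryGroebnerCone_eq hw hle hI hG hred⟩⟩⟩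

end GroebnerFan

end

open GroebnerFan in
theorem proposition3p14 {R : Type*} [CommRing R] [IsNoetherianRing R] {n : ℕ}
    (I : Ideal (MixedRing R n)) (hI : IsXHomogeneous I) (w : Weight n) (hw : w.1 < 0) :
    (IsClosed (groebnerCone I w) ∧ IsRationalPolyhedralCone (groebnerCone I w)) ∧
    (IsClosed (boundaryGroebnerCone I w) ∧ IsRationalPolyhedralCone (boundaryGroebnerCone I w)) ∧
    ∀ le : Mon n → Mon n → Prop, IsMonomialOrdering le →
      (∃ G : Finset (MixedRing R n),
        IsInitiallyReducedStandardBasis (weightedOrder w le) I G) ∧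
      ∀ G : Finset (MixedRing R n),
        IsInitiallyReducedStandardBasis (weightedOrder w le) I G →
        groebnerCone I w = {v | v.1 ≤ 0 ∧ SatisfiesSystem w le G v} ∧
        boundaryGroebnerCone I w = {v | v.1 = 0 ∧ SatisfiesSystem w le G v} := by
  obtain ⟨hcone, hcone', h⟩ := proposition3p14_general I hI w hw
  exact ⟨hcone, hcone', fun le hle => ⟨(h le hle).1, fun G hG => (h le hle).2 G hG.1 hG.2.2⟩⟩
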